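/- Let $q\in\mathbb C^*$ with $q^2\neq 1$, and let $\mathfrak g$ be a simple Lie algebra of simply laced type (or, more generally, fix any symmetric matrix $(\alpha_i,\alpha_j)$ with $(\alpha_i,\alpha_i)=2$ and $(\alpha_i,\alpha_j)\in\{0,-1\}$ for $i\ne j$). Let $U$ be the associative $\mathbb C$-algebra generated by the coefficients of the currents $e_\alpha(z)=\sum_{k\in\mathbb Z}e_{\alpha,k}z^{-k}$, $f_\alpha(z)=\sum_{k\in\mathbb Z}f_{\alpha,k}z^{-k}$, $K^\pm_\alpha(z)=\sum_{k\ge0}K^\pm_{\alpha,k}z^{\mp k}$ ($\alpha$ a simple root, $K^+_{\alpha,0}K^-_{\alpha,0}=K^-_{\alpha,0}K^+_{\alpha,0}=1$) and a central invertible element $q^{c/2}$, subject to all the relations of Drinfeld's new realization of $U_q(\widehat{\mathfrak g})$ except the Serre relations: $$(z-q^{(\alpha,\beta)}w)e_\alpha(z)e_\beta(w)=(q^{(\alpha,\beta)}z-w)e_\beta(w)e_\alpha(z),\qquad (z-q^{-(\alpha,\beta)}w)f_\alpha(z)f_\beta(w)=(q^{-(\alpha,\beta)}z-w)f_\beta(w)f_\alpha(z),$$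 $$(q^{\pm c/2}z-q^{(\alpha,\beta)}w)K^\pm_\alpha(z)e_\beta(w)=(q^{(\alpha,\beta)\pm c/2}z-w)e_\beta(w)K^\pm_\alpha(z),$$ $$(q^{\mp c/2}z-q^{-(\alpha,\beta)}w)K^\pm_\alpha(z)f_\beta(w)=(q^{-(\alpha,\beta)\mp c/2}z-w)f_\beta(w)K^\pm_\alpha(z),$$ $$(z-q^{(\alpha,\beta)-c}w)(z-q^{-(\alpha,\beta)+c}w)K^+_\alpha(z)K^-_\beta(w)=(q^{(\alpha,\beta)+c}z-w)(q^{-(\alpha,\beta)-c}z-w)K^-_\beta(w)K^+_\alpha(z),\qquad [K^\pm_\alpha(z),K^\pm_\beta(w)]=0,$$ $$[e_\alpha(z),f_\beta(w)]=\frac{\delta_{\alpha,\beta}}{q-q^{-1}}\Bigl(\delta(z/q^cw)K^+_\alpha(zq^{-c/2})-\delta(zq^c/w)K^-_\alpha(wq^{-c/2})\Bigr),\qquad \delta(z)=\sum_{k\in\mathbb Z}z^k.$$ Let $V$ be a representation of $U$ in which every vector is annihilated, for each simple root $\alpha$, by $e_{\alpha,n}$ and $f_{\alpha,n}$ for all sufficiently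 large $n$ (as in highest weight representations). Call a linear functional $\xi$ on $V$ restricted if, for each $\alpha$, $\xi\circ e_{\alpha,n}=\xi\circ f_{\alpha,n}=0$ for all sufficiently negative $n$. Fix simple roots $\alpha,\beta$ with $(\alpha,\beta)=-1$. Let $e_{\alpha+\beta}(z)=\,:e_\alpha(qz)e_\beta(q^2z):$ and $f_{\alpha+\beta}(z)=\,:f_\beta(q^2z)f_\alpha(qz):$ be the currents on $V$ defined by $$e_{\alpha+\beta}(z)=\frac1{2\pi i}\Bigl(\oint_{C_\infty}e_\alpha(w)e_\beta(q^2z)\frac{dw}w-\oint_{C_0}\frac{q^{-1}w-q^2z}{w-qz}e_\beta(q^2z)e_\alpha(w)\frac{dw}w\Bigr),$$ $$f_{\alpha+\beta}(z)=\frac1{2\pi i}\Bigl(\oint_{C_\infty}\frac{q^{-1}w-q^2z}{w-qz}f_\alpha(w)f_\beta(q^2z)\frac{dw}w-\oint_{C_0}f_\beta(q^2z)f_\alpha(w)\frac{dw}w\Bigr),$$ where $\frac1{2\pi i}\oint\frac{dw}{w}$ takes the coefficient of $w^0$ and the rational factor is expanded in the region $|w|<|qz|$ for $C_0$ and $|w|>|qz|$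 for $C_\infty$. Then: (a) For every $v\in V$, every restricted $\xi$ and every $z\neq 0$, the two series under the integrals for $e_{\alpha+\beta}$ (respectively $f_{\alpha+\beta}$), taken in the matrix coefficient $\langle\xi,\cdot\,v\rangle$, converge for $|w|>|qz|$ and for $0<|w|<|qz|$ to a single function $\Phi$ holomorphic for $w\ne 0,qz$, and $\langle\xi,e_{\alpha+\beta}(z)v\rangle$ (respectively $\langle\xi,f_{\alpha+\beta}(z)v\rangle$) equals $\frac1{2\pi i}\oint\Phi(w)\frac{dw}w$ over any circle around $w=qz$ of radius less than $|qz|$. (b) On $V$, the Serre relations $$x_\mu(w_1)x_\mu(w_2)x_\nu(z)-(q+q^{-1})x_\mu(w_1)x_\nu(z)x_\mu(w_2)+x_\nu(z)x_\mu(w_1)x_\mu(w_2)+(w_1\leftrightarrow w_2)=0$$ with $x=e$ or $f$ and $(\mu,\nu)=(\alpha,\beta)$ or $(\beta,\alpha)$ are equivalent to the following equalities of Laurent series (the fractions being expanded in the indicated regions): $$e_\alpha(z)e_{\alpha+\beta}(w)=\frac{qz-w}{z-qw}\,e_{\alpha+\beta}(w)e_\alpha(z),\quad |z|<|qw|,\tag{15}$$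 $$e_{\alpha+\beta}(z)e_\beta(w)=\frac{q^2z-q^{-2}w}{qz-q^{-1}w}\,e_\beta(w)e_{\alpha+\beta}(z),\quad |z|<|q^{-2}w|,\tag{16}$$ $$f_\beta(z)f_{\alpha+\beta}(w)=\frac{q^{-2}z-q^2w}{q^{-1}z-qw}\,f_{\alpha+\beta}(w)f_\beta(z),\quad |z|<|q^2w|,\tag{17}$$ $$f_{\alpha+\beta}(z)f_\alpha(w)=\frac{q^{-1}z-w}{z-q^{-1}w}\,f_\alpha(w)f_{\alpha+\beta}(z),\quad |z|<|q^{-1}w|.\tag{18}$$ More precisely, (15), (16), (17), (18) are respectively equivalent to the Serre relation for $(x,\mu,\nu)=(e,\alpha,\beta)$, $(e,\beta,\alpha)$, $(f,\beta,\alpha)$, $(f,\alpha,\beta)$. (c) When it holds, each of (15)–(18), written $X(z)Y(w)=\frac{az-bw}{cz-dw}Y(w)X(z)$, is also an identity of meromorphic functions on $(\mathbb C^*)^2$ in every matrix coefficient $\langle\xi,\cdot\,v\rangle$ with $v\in V$ and $\xi$ restricted: the series $X(z)Y(w)$ converges on all of $(\mathbb C^*)^2$ to a holomorphic function $F$, the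 series $Y(w)X(z)$ converges for $|az|<|bw|$ to a function $G$ that is holomorphic on $(\mathbb C^*)^2$ off $az=bw$, and $F=\frac{az-bw}{cz-dw}G$ wherever $az\ne bw$ and $cz\neq dw$. Conversely, if the restricted functionals separate the vectors of $V$, these identities imply the corresponding Serre relation. -/

import Mathlib

open scoped Real

namespace DrinfeldCurrent

noncomputable section

/-- Symmetric Cartan matrices of simply laced type, `A i j = (α_i, α_j)`. The Cartan matrix of every
simple Lie algebra of simply laced type (`A_n`, `D_n`, `E_6`, `E_7`, `E_8`) is of this kind. -/
structure IsSimplyLacedCartan {ι : Type*} (A : Matrix ι ι ℤ) : Prop where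
  diag : ∀ i, A i i = 2
  symm : ∀ i j, A i j = A j i
  offDiag : ∀ i j, i ≠ j → A i j = 0 ∨ A i j = -1

/-! ### The algebra of currents without the Serre relations -/

/-- Generators: the modes of `e_i(z) = ∑ e_{i,k} z^{-k}` and `f_i(z) = ∑ f_{i,k} z^{-k}`, the modes
of `K_i^+(z) = ∑_{k ≥ 0} K^+_{i,k} z^{-k}` and `K_i^-(z) = ∑_{k ≥ 0} K^-_{i,k} z^{k}`, and the central
element `γ = q^{c/2}` with its inverse. -/
inductive Gen (ι : Type*) where
  | e (i : ι) (k : ℤ)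
  | f (i : ι) (k : ℤ)
  | Kplus (i : ι) (k : ℕ)
  | Kminus (i : ι) (k : ℕ)
  | gamma
  | gammaInv

/-- The free algebra on the generators. -/
abbrev Free (ι : Type*) := FreeAlgebra ℂ (Gen ι)

namespace Free

variable {ι : Type*}

/-- `e_{i,n}`, the coefficient of `z^{-n}` in `e_i(z)`. -/
def e (i : ι) (n : ℤ) : Free ι := FreeAlgebra.ι ℂ (Gen.e i n)

/-- `f_{i,n}`, the coefficient of `z^{-n}` in `f_i(z)`. -/
def f (i : ι) (n : ℤ) : Free ι := FreeAlgebra.ι ℂ (Gen.f i n)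

/-- The coefficient of `z^{-n}` in `K_i^+(z)`; it vanishes for `n < 0`. -/
def Kp (i : ι) (n : ℤ) : Free ι :=
  if 0 ≤ n then FreeAlgebra.ι ℂ (Gen.Kplus i n.toNat) else 0

/-- The coefficient of `z^{-n}` in `K_i^-(z)`; it vanishes for `n > 0`. -/
def Km (i : ι) (n : ℤ) : Free ι :=
  if n ≤ 0 then FreeAlgebra.ι ℂ (Gen.Kminus i (-n).toNat) else 0

/-- `γ ^ n = q^{nc/2}` for an integer `n`. -/
def g (n : ℤ) : Free ι :=
  if 0 ≤ n then FreeAlgebra.ι ℂ Gen.gamma ^ n.toNat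
  else FreeAlgebra.ι ℂ Gen.gammaInv ^ (-n).toNat

end Free

open Free in
/-- The defining relations other than the Serre relations. Each constructor is the equality of the
coefficients of `z^{-n} w^{-m}` in the relation between currents that is displayed with it
(denominators cleared), with `a = (α_i, α_j)`. -/
inductive Rel {ι : Type*} [DecidableEq ι] (A : Matrix ι ι ℤ) (q : ℂ) : Free ι → Free ι → Prop
  | gamma_inv : Rel A q (g 1 * g (-1)) 1
  | inv_gamma : Rel A q (g (-1) * g 1) 1
  | gamma_central (x : Gen ι) :
      Rel A q (g 1 * FreeAlgebra.ι ℂ x) (FreeAlgebra.ι ℂ x * g 1)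
  /-- The constant terms of `K_i^±` are `k_i^{±1}`. -/
  | k_inv (i : ι) : Rel A q (Kp i 0 * Km i 0) 1
  | inv_k (i : ι) : Rel A q (Km i 0 * Kp i 0) 1
  /-- `(z - q^a w) e_i(z) e_j(w) = (q^a z - w) e_j(w) e_i(z)`. -/
  | ee (i j : ι) (n m : ℤ) :
      Rel A q (e i (n + 1) * e j m - q ^ A i j • (e i n * e j (m + 1)))
        (q ^ A i j • (e j m * e i (n + 1)) - e j (m + 1) * e i n)
  /-- `(z - q^{-a} w) f_i(z) f_j(w) = (q^{-a} z - w) f_j(w) f_i(z)`. -/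
  | ff (i j : ι) (n m : ℤ) :
      Rel A q (f i (n + 1) * f j m - q ^ (-A i j) • (f i n * f j (m + 1)))
        (q ^ (-A i j) • (f j m * f i (n + 1)) - f j (m + 1) * f i n)
  /-- `(γ z - q^a w) K_i^+(z) e_j(w) = (q^a γ z - w) e_j(w) K_i^+(z)`. -/
  | Kpe (i j : ι) (n m : ℤ) :
      Rel A q (g 1 * Kp i (n + 1) * e j m - q ^ A i j • (Kp i n * e j (m + 1)))
        (q ^ A i j • (g 1 * e j m * Kp i (n + 1)) - e j (m + 1) * Kp i n)
  /-- `(γ⁻¹ z - q^a w) K_i^-(z) e_j(w) = (q^a γ⁻¹ z - w) e_j(w) K_i^-(z)`. -/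
  | Kme (i j : ι) (n m : ℤ) :
      Rel A q (g (-1) * Km i (n + 1) * e j m - q ^ A i j • (Km i n * e j (m + 1)))
        (q ^ A i j • (g (-1) * e j m * Km i (n + 1)) - e j (m + 1) * Km i n)
  /-- `(γ⁻¹ z - q^{-a} w) K_i^+(z) f_j(w) = (q^{-a} γ⁻¹ z - w) f_j(w) K_i^+(z)`. -/
  | Kpf (i j : ι) (n m : ℤ) :
      Rel A q (g (-1) * Kp i (n + 1) * f j m - q ^ (-A i j) • (Kp i n * f j (m + 1)))
        (q ^ (-A i j) • (g (-1) * f j m * Kp i (n + 1)) - f j (m + 1) * Kp i n)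
  /-- `(γ z - q^{-a} w) K_i^-(z) f_j(w) = (q^{-a} γ z - w) f_j(w) K_i^-(z)`. -/
  | Kmf (i j : ι) (n m : ℤ) :
      Rel A q (g 1 * Km i (n + 1) * f j m - q ^ (-A i j) • (Km i n * f j (m + 1)))
        (q ^ (-A i j) • (g 1 * f j m * Km i (n + 1)) - f j (m + 1) * Km i n)
  /-- `(z - q^a γ⁻² w)(z - q^{-a} γ² w) K_i^+(z) K_j^-(w)
      = (q^a γ² z - w)(q^{-a} γ⁻² z - w) K_j^-(w) K_i^+(z)`. -/
  | KpKm (i j : ι) (n m : ℤ) :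
      Rel A q
        (Kp i (n + 2) * Km j m
          - (q ^ A i j • g (-2) + q ^ (-A i j) • g 2) * (Kp i (n + 1) * Km j (m + 1))
          + Kp i n * Km j (m + 2))
        (Km j m * Kp i (n + 2)
          - (q ^ A i j • g 2 + q ^ (-A i j) • g (-2)) * (Km j (m + 1) * Kp i (n + 1))
          + Km j (m + 2) * Kp i n)
  | KpKp (i j : ι) (n m : ℤ) : Rel A q (Kp i n * Kp j m) (Kp j m * Kp i n)
  | KmKm (i j : ι) (n m : ℤ) : Rel A q (Km i n * Km j m) (Km j m * Km i n)
  /-- `[e_i(z), f_j(w)]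
      = δ_{ij} (q - q⁻¹)⁻¹ (δ(z / γ² w) K_i^+(z γ⁻¹) - δ(z γ² / w) K_i^-(w γ⁻¹))`. -/
  | ef (i j : ι) (n m : ℤ) :
      Rel A q (e i n * f j m - f j m * e i n)
        (if i = j then
          (q - q⁻¹)⁻¹ • (g (n - m) * Kp i (n + m) - g (m - n) * Km i (n + m))
        else 0)

/-- The algebra generated by the currents `e_i`, `f_i`, `K_i^±` subject to all the defining relations
of the quantum affine algebra in its new realization except the Serre relations. -/
abbrev Alg {ι : Type*} [DecidableEq ι] (A : Matrix ι ι ℤ) (q : ℂ) := RingQuot (Rel A q)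

section Modes

variable {ι : Type*} [DecidableEq ι] (A : Matrix ι ι ℤ) (q : ℂ)

/-- The mode `e_{i,n}` in the algebra. -/
def eMode (i : ι) (n : ℤ) : Alg A q := RingQuot.mkAlgHom ℂ (Rel A q) (Free.e i n)

/-- The mode `f_{i,n}` in the algebra. -/
def fMode (i : ι) (n : ℤ) : Alg A q := RingQuot.mkAlgHom ℂ (Rel A q) (Free.f i n)

end Modes

/-! ### Serre relations -/

/-- The coefficient of `w_1^{-n_1} w_2^{-n_2} z^{-m}` in
`x(w_1)x(w_2)y(z) - [2]_q x(w_1)y(z)x(w_2) + y(z)x(w_1)x(w_2)`. -/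
def serreHalf {R : Type*} [Ring R] [Algebra ℂ R] (q : ℂ) (x y : ℤ → R) (n₁ n₂ m : ℤ) : R :=
  x n₁ * x n₂ * y m - (q + q⁻¹) • (x n₁ * y m * x n₂) + y m * x n₁ * x n₂

/-- The coefficient of `w_1^{-n_1} w_2^{-n_2} z^{-m}` in the left-hand side of the Serre relation
for the currents `x`, `y`. -/
def serre {R : Type*} [Ring R] [Algebra ℂ R] (q : ℂ) (x y : ℤ → R) (n₁ n₂ m : ℤ) : R :=
  serreHalf q x y n₁ n₂ m + serreHalf q x y n₂ n₁ m

/-! ### Representations -/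

section Rep

variable {ι : Type*} [DecidableEq ι] {A : Matrix ι ι ℤ} {q : ℂ}
variable {V : Type*} [AddCommGroup V] [Module ℂ V]

/-- The property that characterizes the category of highest weight representations: every vector is
annihilated by the modes `e_{i,n}`, `f_{i,n}` with `n` big enough. -/
def IsHighestWeight (ρ : Alg A q →ₐ[ℂ] Module.End ℂ V) : Prop :=
  ∀ (v : V) (i : ι), ∃ N : ℤ, ∀ n ≥ N, ρ (eMode A q i n) v = 0 ∧ ρ (fMode A q i n) v = 0

/-- The restricted dual: functionals that are annihilated by the (transposed) modes `e_{i,n}`,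
`f_{i,n}` with `-n` big enough. Matrix coefficients are taken against these. -/
def IsRestricted (ρ : Alg A q →ₐ[ℂ] Module.End ℂ V) (ξ : V →ₗ[ℂ] ℂ) : Prop :=
  ∀ i : ι, ∃ N : ℤ, ∀ n ≤ N, ∀ v : V, ξ (ρ (eMode A q i n) v) = 0 ∧ ξ (ρ (fMode A q i n) v) = 0

/-- The restricted dual separates the vectors of the representation. -/
def RestrictedSeparates (ρ : Alg A q →ₐ[ℂ] Module.End ℂ V) : Prop :=
  ∀ v : V, (∀ ξ : V →ₗ[ℂ] ℂ, IsRestricted ρ ξ → ξ v = 0) → v = 0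

/-- The current `e_i(z)` acting on the representation, through its modes. -/
def eCur (ρ : Alg A q →ₐ[ℂ] Module.End ℂ V) (i : ι) (n : ℤ) (v : V) : V := ρ (eMode A q i n) v

/-- The current `f_i(z)` acting on the representation, through its modes. -/
def fCur (ρ : Alg A q →ₐ[ℂ] Module.End ℂ V) (i : ι) (n : ℤ) (v : V) : V := ρ (fMode A q i n) v

/-- The Serre relation between `e_i` (twice) and `e_j` holds in the representation. -/
def SerreE (ρ : Alg A q →ₐ[ℂ] Module.End ℂ V) (i j : ι) : Prop :=
  ∀ n₁ n₂ m : ℤ, ρ (serre q (eMode A q i) (eMode A q j) n₁ n₂ m) = 0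

/-- The Serre relation between `f_i` (twice) and `f_j` holds in the representation. -/
def SerreF (ρ : Alg A q →ₐ[ℂ] Module.End ℂ V) (i j : ι) : Prop :=
  ∀ n₁ n₂ m : ℤ, ρ (serre q (fMode A q i) (fMode A q j) n₁ n₂ m) = 0

end Rep

/-! ### Laurent series in two variables with values in operators

A current is given by its modes `X : ℤ → V → V`, `X(z) = ∑ X_n z^{-n}`; a series in `z, w` by
`S : ℤ → ℤ → V → V`, where `S n m` is the coefficient of `z^{-n} w^{-m}`. -/

section Series

variable {V : Type*} [AddCommGroup V] [Module ℂ V]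

/-- The Laurent expansion of `(a z - b w) / (c z - d w)` in the region `|c z| < |d w|`, as a power
series in `t = z / w` (for `d ≠ 0`). -/
def ratio (a b c d : ℂ) : PowerSeries ℂ :=
  (PowerSeries.C b - PowerSeries.C a * PowerSeries.X) *
    (PowerSeries.C d - PowerSeries.C c * PowerSeries.X)⁻¹

/-- The product of the series `r(z/w)` and `S(z, w)`. For every series to which it is applied here,
the sum over `k` is finite on each vector of a highest weight representation. -/
def seriesMul (r : PowerSeries ℂ) (S : ℤ → ℤ → V → V) (n m : ℤ) (v : V) : V :=
  ∑ᶠ k : ℕ, PowerSeries.coeff k r • S (n + k) (m - k) v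

/-- The equality of Laurent series
`X(z) Y(w) = (a z - b w)/(c z - d w) Y(w) X(z)`, `|c z| < |d w|`. -/
def Exchange (a b c d : ℂ) (X Y : ℤ → V → V) : Prop :=
  ∀ (n m : ℤ) (v : V),
    X n (Y m v) = seriesMul (ratio a b c d) (fun n' m' u => Y m' (X n' u)) n m v

/-- The analytic continuation of `X(z) Y(w)` into the region `|z| < |p w|`, as the Laurent series
`(p z - w)/(z - p w) Y(w) X(z)`, for currents with `(z - p w) X(z) Y(w) = (p z - w) Y(w) X(z)`. -/
def continued (p : ℂ) (X Y : ℤ → V → V) : ℤ → ℤ → V → V :=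
  seriesMul (ratio p 1 1 p) (fun n m u => Y m (X n u))

/-- Let `outer` and `inner` be the Laurent series in `w, x` (coefficients of `w^{-n} x^{-m}`) of the
same function in the regions `|w| > |q⁻¹ x|` and `|w| < |q⁻¹ x|`. With `x = q² z`, this is the mode
of index `n` of
`(2πi)⁻¹ (∮_{C_∞} outer(w, q² z) dw/w - ∮_{C_0} inner(w, q² z) dw/w)`,
the contour integrals being coefficients of `w^0`. -/
def contourDifference (q : ℂ) (outer inner : ℤ → ℤ → V → V) (n : ℤ) (v : V) : V :=
  q ^ (-2 * n) • (outer 0 n v - inner 0 n v)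

/-- The product `ea(w) eb(x)` in the region `|w| > |q⁻¹ x|`. -/
def outerE (ea eb : ℤ → V → V) (n m : ℤ) (v : V) : V := ea n (eb m v)

/-- The product `ea(w) eb(x)` continued to the region `|w| < |q⁻¹ x|`. -/
def innerE (q : ℂ) (ea eb : ℤ → V → V) (n m : ℤ) (v : V) : V := continued q⁻¹ ea eb n m v

/-- The product `fb(x) fa(w)` continued to the region `|x| < |q w|`. -/
def outerF (q : ℂ) (fa fb : ℤ → V → V) (n m : ℤ) (v : V) : V := continued q fb fa m n v

/-- The product `fb(x) fa(w)` in the region `|x| > |q w|`. -/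
def innerF (fa fb : ℤ → V → V) (n m : ℤ) (v : V) : V := fb m (fa n v)

/-- The composed root current `e_{α+β}(z) = :e_α(qz) e_β(q²z):`. -/
def composedE (q : ℂ) (ea eb : ℤ → V → V) : ℤ → V → V :=
  contourDifference q (outerE ea eb) (innerE q ea eb)

/-- The composed root current `f_{α+β}(z) = :f_β(q²z) f_α(qz):`. -/
def composedF (q : ℂ) (fa fb : ℤ → V → V) : ℤ → V → V :=
  contourDifference q (outerF q fa fb) (innerF fa fb)

/-! ### Matrix coefficients as analytic functions -/

/-- In the matrix coefficient `⟨ξ, · v⟩`, for every `z ≠ 0` the series `outer(w, q² z)` and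
`inner(w, q² z)` converge for `|w| > |qz|` and `0 < |w| < |qz|` to one function `Φ`, holomorphic for
`w ≠ 0, qz`, and
`C(z) = (2πi)⁻¹ ∮ Φ(w) dw/w` over a circle around `w = qz`. -/
def IsContourIntegral (q : ℂ) (outer inner : ℤ → ℤ → V → V) (C : ℤ → V → V)
    (ξ : V →ₗ[ℂ] ℂ) (v : V) : Prop :=
  ∀ z : ℂ, z ≠ 0 → ∃ Φ : ℂ → ℂ,
    DifferentiableOn ℂ Φ {w | w ≠ 0 ∧ w ≠ q * z} ∧
    (∀ w : ℂ, ‖q * z‖ < ‖w‖ →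
      HasSum (fun p : ℤ × ℤ => ξ (outer p.1 p.2 v) * w ^ (-p.1) * (q ^ 2 * z) ^ (-p.2)) (Φ w)) ∧
    (∀ w : ℂ, w ≠ 0 → ‖w‖ < ‖q * z‖ →
      HasSum (fun p : ℤ × ℤ => ξ (inner p.1 p.2 v) * w ^ (-p.1) * (q ^ 2 * z) ^ (-p.2)) (Φ w)) ∧
    (∀ r : ℝ, 0 < r → r < ‖q * z‖ →
      HasSum (fun n : ℤ => ξ (C n v) * z ^ (-n))
        ((2 * π * Complex.I)⁻¹ * ∮ w in C(q * z, r), Φ w / w))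

/-- In the matrix coefficient `⟨ξ, · v⟩`, the identity of meromorphic functions on `(ℂ^*)²`
`X(z) Y(w) = (a z - b w)/(c z - d w) Y(w) X(z)`:
the series `X(z) Y(w)` converges on all of `(ℂ^*)²` to a holomorphic function `F`, the series
`Y(w) X(z)` converges for `|a z| < |b w|` to a function `G` holomorphic on `(ℂ^*)²` off the line
`a z = b w`, and `F = (a z - b w)/(c z - d w) G`. -/
def AnalyticExchange (a b c d : ℂ) (X Y : ℤ → V → V) (ξ : V →ₗ[ℂ] ℂ) (v : V) : Prop :=
  ∃ F G : ℂ × ℂ → ℂ,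
    AnalyticOnNhd ℂ F {p | p.1 ≠ 0 ∧ p.2 ≠ 0} ∧
    AnalyticOnNhd ℂ G {p | p.1 ≠ 0 ∧ p.2 ≠ 0 ∧ a * p.1 ≠ b * p.2} ∧
    (∀ z w : ℂ, z ≠ 0 → w ≠ 0 →
      HasSum (fun p : ℤ × ℤ => ξ (X p.1 (Y p.2 v)) * z ^ (-p.1) * w ^ (-p.2)) (F (z, w))) ∧
    (∀ z w : ℂ, z ≠ 0 → w ≠ 0 → ‖a * z‖ < ‖b * w‖ →
      HasSum (fun p : ℤ × ℤ => ξ (Y p.2 (X p.1 v)) * z ^ (-p.1) * w ^ (-p.2)) (G (z, w))) ∧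
    (∀ z w : ℂ, z ≠ 0 → w ≠ 0 → a * z ≠ b * w → c * z ≠ d * w →
      F (z, w) = (a * z - b * w) / (c * z - d * w) * G (z, w))

end Series

section ExchangeInRep

variable {ι : Type*} [DecidableEq ι] {A : Matrix ι ι ℤ} {q : ℂ}
variable {V : Type*} [AddCommGroup V] [Module ℂ V]

/-- `AnalyticExchange` in all the matrix coefficients of a representation. -/
def AnalyticExchangeIn (ρ : Alg A q →ₐ[ℂ] Module.End ℂ V) (a b c d : ℂ) (X Y : ℤ → V → V) : Prop :=
  ∀ (ξ : V →ₗ[ℂ] ℂ) (v : V), IsRestricted ρ ξ → AnalyticExchange a b c d X Y ξ v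

/-- `X(z) Y(w) = (a z - b w)/(c z - d w) Y(w) X(z)` is equivalent to the relation `S`: as an equality
of Laurent series (`|c z| < |d w|`), and then also as an identity of meromorphic functions on
`(ℂ^*)²`, which conversely suffices if the matrix coefficients determine the operators. -/
def EquivalentToExchange (ρ : Alg A q →ₐ[ℂ] Module.End ℂ V) (S : Prop) (a b c d : ℂ)
    (X Y : ℤ → V → V) : Prop :=
  (S ↔ Exchange a b c d X Y) ∧
  (S → AnalyticExchangeIn ρ a b c d X Y) ∧
  (RestrictedSeparates ρ → AnalyticExchangeIn ρ a b c d X Y → S)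

end ExchangeInRep

end

end DrinfeldCurrent

open DrinfeldCurrent

/-!
The quadratic relation of `e_α` and `e_β` has a simple pole, so the product `a(x) b(y)` and its
continuation from the region `|x| < |s y|` differ by a delta function supported on `x = s y`; its
coefficient is, up to rescaling, the composed current. Dividing out the exchange factors, half of
the Serre expression becomes a multiple of delta functions, which carry the defect of the exchange
relation with the composed current, plus a remainder. The remainders cancel because the Serre
expression is annihilated by `(x₁ - s y) (x₂ - s y)`, so the Serre relation says that the defect
vanishes.

In a matrix coefficient, the product times the linear factor of the pole has coefficients that
vanish outside a bounded region, hence is a Laurent polynomial: both expansions sum to one rational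
function with a simple pole, and the delta function becomes its residue.
-/

namespace DrinfeldCurrent

noncomputable section

/-! ### Expansions of the exchange factors -/

section Ratio

variable {a b c d : ℂ}

theorem eq_ratio_iff (hd : d ≠ 0) {r : PowerSeries ℂ} :
    r = ratio a b c d ↔
      r * (PowerSeries.C d - PowerSeries.C c * PowerSeries.X) =
        PowerSeries.C b - PowerSeries.C a * PowerSeries.X :=
  PowerSeries.eq_mul_inv_iff_mul_eq (by simpa using hd)

theorem ratio_mul (hd : d ≠ 0) :
    ratio a b c d * (PowerSeries.C d - PowerSeries.C c * PowerSeries.X) =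
      PowerSeries.C b - PowerSeries.C a * PowerSeries.X :=
  (eq_ratio_iff hd).1 rfl

theorem ratio_mul_left (hd : d ≠ 0) {t : ℂ} (ht : t ≠ 0) :
    ratio (t * a) (t * b) (t * c) (t * d) = ratio a b c d := by
  symm
  rw [eq_ratio_iff (mul_ne_zero ht hd)]
  simp only [map_mul]
  linear_combination PowerSeries.C t * ratio_mul (a := a) (b := b) (c := c) hd

theorem rescale_ratio (hd : d ≠ 0) (t : ℂ) :
    PowerSeries.rescale t (ratio a b c d) = ratio (a * t) b (c * t) d := by
  have h := congrArg (PowerSeries.rescale t) (ratio_mul (a := a) (b := b) (c := c) hd)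
  have rescale_C (x : ℂ) : PowerSeries.rescale t (PowerSeries.C x) = PowerSeries.C x := by
    ext n
    cases n <;> simp [PowerSeries.coeff_C]
  rw [eq_ratio_iff hd]
  simpa only [map_mul, map_sub, rescale_C, PowerSeries.rescale_X, mul_assoc] using h

theorem ratio_inv_sq_one_self {s : ℂ} (hs : s ≠ 0) :
    ratio s⁻¹ (s ^ 2) 1 s = PowerSeries.C (s + s⁻¹) - ratio s 1 1 s := by
  symm
  rw [eq_ratio_iff hs, sub_mul, ratio_mul hs, mul_sub, ← mul_assoc, ← map_mul, ← map_mul,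
    show (s + s⁻¹) * s = s ^ 2 + 1 by field_simp]
  simp only [map_add, mul_one]
  ring

end Ratio

/-! ### Products of a power series in `z / w` with a series of operators -/

section SeriesMul

variable {V : Type*} [AddCommGroup V] [Module ℂ V] {S : ℤ → ℤ → V → V} {v : V} {N : ℤ}

theorem seriesMul_eq_sum_of_bound (r : PowerSeries ℂ) (h : ∀ n ≥ N, ∀ m, S n m v = 0) {n : ℤ}
    {K : ℕ} (hK : N ≤ n + K) (m : ℤ) :
    seriesMul r S n m v = ∑ k ∈ Finset.range K, PowerSeries.coeff k r • S (n + k) (m - k) v := by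
  apply finsum_eq_sum_of_support_subset
  intro k hk
  simp only [Function.mem_support, Finset.coe_range, Set.mem_Iio] at hk ⊢
  by_contra hKk
  exact hk (by rw [h _ (by omega), smul_zero])

theorem map_seriesMul {W : Type*} [AddCommGroup W] [Module ℂ W] (L : V →ₗ[ℂ] W)
    (r : PowerSeries ℂ) (h : ∀ n ≥ N, ∀ m, S n m v = 0) (n m : ℤ) :
    L (seriesMul r S n m v) = ∑ᶠ k : ℕ, PowerSeries.coeff k r • L (S (n + k) (m - k) v) := by
  have h_finite : (fun k : ℕ => PowerSeries.coeff k r • S (n + k) (m - k) v).HasFiniteSupport :=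
    (Finset.range (N - n).toNat).finite_toSet.subset fun k hk => by
      by_contra hkN
      simp only [Finset.coe_range, Set.mem_Iio] at hkN
      exact hk (by beta_reduce; rw [h _ (by omega), smul_zero])
  exact (L.toAddMonoidHom.map_finsum h_finite).trans (finsum_congr fun k => map_smul L _ _)

theorem seriesMul_eq_zero (r : PowerSeries ℂ) {n m : ℤ}
    (h : ∀ k : ℕ, S (n + k) (m - k) v = 0) : seriesMul r S n m v = 0 := by
  simp only [seriesMul, h, smul_zero, finsum_zero]

theorem seriesMul_C (t : ℂ) (S : ℤ → ℤ → V → V) (n m : ℤ) (v : V) :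
    seriesMul (PowerSeries.C t) S n m v = t • S n m v := by
  rw [seriesMul, finsum_eq_single _ 0 fun k hk => by simp [PowerSeries.coeff_C, hk]]
  simp

theorem seriesMul_C_mul (t : ℂ) (r : PowerSeries ℂ) (S : ℤ → ℤ → V → V) (n m : ℤ) (v : V) :
    seriesMul (PowerSeries.C t * r) S n m v = t • seriesMul r S n m v := by
  simp only [seriesMul, PowerSeries.coeff_C_mul, mul_smul, smul_finsum]

theorem seriesMul_sub (r r' : PowerSeries ℂ) (h : ∀ n ≥ N, ∀ m, S n m v = 0) (n m : ℤ) :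
    seriesMul (r - r') S n m v = seriesMul r S n m v - seriesMul r' S n m v := by
  have hK : N ≤ n + (N - n).toNat := by omega
  simp only [seriesMul_eq_sum_of_bound _ h hK, map_sub, sub_smul, Finset.sum_sub_distrib]

theorem seriesMul_X_mul (r : PowerSeries ℂ) (h : ∀ n ≥ N, ∀ m, S n m v = 0) (n m : ℤ) :
    seriesMul (PowerSeries.X * r) S n m v = seriesMul r S (n + 1) (m - 1) v := by
  rw [seriesMul_eq_sum_of_bound _ h (K := (N - n).toNat + 1) (by push_cast; omega),
    seriesMul_eq_sum_of_bound _ h (K := (N - n).toNat) (by omega), Finset.sum_range_succ',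
    PowerSeries.coeff_zero_X_mul, zero_smul, add_zero]
  refine Finset.sum_congr rfl fun k _ => ?_
  rw [PowerSeries.coeff_succ_X_mul]
  congr 2 <;> push_cast <;> ring

theorem seriesMul_smul {t : ℂ} {w : ℤ → ℤ → ℂ}
    (hw : ∀ n m (k : ℕ), w (n + k) (m - k) = t ^ k * w n m) (r : PowerSeries ℂ)
    (S : ℤ → ℤ → V → V) (n m : ℤ) (v : V) :
    seriesMul r (fun n m u => w n m • S n m u) n m v =
      w n m • seriesMul (PowerSeries.rescale t r) S n m v := by
  simp only [seriesMul, smul_finsum, PowerSeries.coeff_rescale, hw, smul_smul]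
  exact finsum_congr fun k => by ring_nf

end SeriesMul

/-! ### Multiplication of a double series by `c z - d w` -/

section BinomialMul

variable {K M : Type*} [Field K] [AddCommGroup M] [Module K M] {c d : K}

/-- The coefficient of `z^{-n} w^{-m}` in `(c z - d w) S(z, w)`, where `S n m` is the coefficient of
`z^{-n} w^{-m}` in the double series `S(z, w)`: the two-term recurrences to which relations between
currents amount. -/
def binomialMul (c d : K) (S : ℤ → ℤ → M) (n m : ℤ) : M := c • S (n + 1) m - d • S n (m + 1)

theorem binomialMul_swap (c d : K) (S : ℤ → ℤ → M) (n m : ℤ) :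
    binomialMul d c (fun m n => S n m) m n = -binomialMul c d S n m :=
  (neg_sub _ _).symm

theorem binomialMul_sub (S T : ℤ → ℤ → M) (n m : ℤ) :
    binomialMul c d (fun n m => S n m - T n m) n m =
      binomialMul c d S n m - binomialMul c d T n m := by
  simp only [binomialMul]
  module

theorem eq_zpow_smul_of_binomialMul_eq_zero (hc : c ≠ 0) (hd : d ≠ 0) {S : ℤ → ℤ → M}
    (h : ∀ n m, binomialMul c d S n m = 0) (n m : ℤ) : S n m = (d / c) ^ n • S 0 (n + m) := by
  have hdc : d / c ≠ 0 := div_ne_zero hd hc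
  have step (n m : ℤ) : S (n + 1) m = (d / c) • S n (m + 1) := by
    rw [div_eq_inv_mul, mul_smul, eq_inv_smul_iff₀ hc]
    exact sub_eq_zero.1 (h n m)
  induction n using Int.induction_on generalizing m with
  | zero => simp
  | succ n ih =>
    rw [step, ih, smul_smul, zpow_add_one₀ hdc, mul_comm, add_right_comm, ← add_assoc]
  | pred n ih =>
    have h_step := step (-n - 1) (m - 1)
    rw [sub_add_cancel, sub_add_cancel, ← inv_smul_eq_iff₀ hdc] at h_step
    rw [← h_step, ih, smul_smul, zpow_sub_one₀ hdc, mul_comm, add_sub, sub_add_eq_add_sub]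

theorem eq_zero_of_binomialMul_eq_zero (hc : c ≠ 0) (hd : d ≠ 0) {S : ℤ → ℤ → M}
    (h : ∀ n m, binomialMul c d S n m = 0) (h_zero : ∀ t, ∃ n, S n (t - n) = 0) (n m : ℤ) :
    S n m = 0 := by
  obtain ⟨k, hk⟩ := h_zero (n + m)
  rw [eq_zpow_smul_of_binomialMul_eq_zero hc hd h, add_sub_cancel,
    smul_eq_zero_iff_right (zpow_ne_zero _ (div_ne_zero hd hc))] at hk
  rw [eq_zpow_smul_of_binomialMul_eq_zero hc hd h, hk, smul_zero]

/-- The symmetry in `i`, `j` turns the vanishing for suitable `i` into the vanishing for suitable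
`j`, which the second factor needs. -/
theorem eq_zero_of_binomialMul_binomialMul_eq_zero (hc : c ≠ 0) (hd : d ≠ 0) {W : ℤ → ℤ → ℤ → M}
    (h_symm : ∀ i j k, W i j k = W j i k) {l : Filter ℤ} [l.NeBot]
    (h_zero : ∀ j t, ∀ᶠ i in l, W i j (t - i) = 0)
    (h : ∀ i j k,
      binomialMul c d (fun i k => binomialMul c d (fun j k => W i j k) j k) i k = 0)
    (i j k : ℤ) : W i j k = 0 := by
  have inner_eq_zero (j i k : ℤ) : binomialMul c d (fun j k => W i j k) j k = 0 := by
    refine eq_zero_of_binomialMul_eq_zero hc hd (fun i k => h i j k) (fun t => ?_) i k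
    obtain ⟨i, h₁, h₂⟩ := ((h_zero (j + 1) t).and (h_zero j (t + 1))).exists
    refine ⟨i, ?_⟩
    rw [binomialMul, h₁, sub_add_eq_add_sub, h₂, smul_zero, smul_zero, sub_zero]
  refine eq_zero_of_binomialMul_eq_zero hc hd (fun j k => inner_eq_zero j i k) (fun t => ?_) j k
  simpa only [h_symm i] using (h_zero i t).exists

theorem binomialMul_seriesMul_ratio {V : Type*} [AddCommGroup V] [Module ℂ V]
    (a b c : ℂ) {d : ℂ} (hd : d ≠ 0) {S : ℤ → ℤ → V → V} {v : V} {N : ℤ}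
    (h : ∀ n ≥ N, ∀ m, S n m v = 0) (n m : ℤ) :
    binomialMul c d (fun n m => seriesMul (ratio a b c d) S n m v) n m =
      binomialMul a b (fun n m => S n m v) n m := by
  have key := congrArg (seriesMul · S n (m + 1) v)
    ((mul_comm _ _).trans (ratio_mul (a := a) (b := b) (c := c) hd))
  simp only [sub_mul, mul_assoc, seriesMul_sub _ _ h, seriesMul_C_mul, seriesMul_X_mul _ h,
    seriesMul_C, add_sub_cancel_right] at key
  rw [← mul_one PowerSeries.X, seriesMul_X_mul _ h, ← map_one PowerSeries.C, seriesMul_C,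
    one_smul, add_sub_cancel_right] at key
  rw [binomialMul, binomialMul, ← neg_sub, key, neg_sub]

end BinomialMul

/-! ### Quadratic relations -/

section Quadratic

variable {R : Type*} [Ring R] [Algebra ℂ R]

/-- The quadratic relation `(z - p w) x(z) y(w) = (p z - w) y(w) x(z)` between the currents with
modes `x`, `y`, coefficient by coefficient. -/
def QuadraticRel (p : ℂ) (x y : ℤ → R) : Prop :=
  ∀ n m, x (n + 1) * y m - p • (x n * y (m + 1)) = p • (y m * x (n + 1)) - y (m + 1) * x n

namespace QuadraticRel

variable {p s : ℂ} {x y a b : ℤ → R}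

theorem symm (h : QuadraticRel p x y) : QuadraticRel p y x := fun n m => by
  linear_combination (norm := module) h m n

theorem map {R' : Type*} [Ring R'] [Algebra ℂ R'] (h : QuadraticRel p x y) (φ : R →ₐ[ℂ] R') :
    QuadraticRel p (fun n => φ (x n)) (fun n => φ (y n)) := fun n m => by
  simpa only [map_sub, map_smul, map_mul] using congrArg φ (h n m)

theorem inv_smul (hp : p ≠ 0) (h : QuadraticRel p⁻¹ x y) (n m : ℤ) :
    p • (x (n + 1) * y m) - x n * y (m + 1) = y m * x (n + 1) - p • (y (m + 1) * x n) := by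
  simpa only [smul_sub, smul_inv_smul₀ hp] using congrArg (p • ·) (h n m)

theorem mul_left (h : QuadraticRel p x y) (r : R) (n m : ℤ) :
    r * x (n + 1) * y m - p • (r * x n * y (m + 1)) =
      p • (r * y m * x (n + 1)) - r * y (m + 1) * x n := by
  simpa only [mul_sub, mul_smul_comm, mul_assoc] using congrArg (r * ·) (h n m)

theorem mul_right (h : QuadraticRel p x y) (r : R) (n m : ℤ) :
    x (n + 1) * y m * r - p • (x n * y (m + 1) * r) =
      p • (y m * x (n + 1) * r) - y (m + 1) * x n * r := by
  simpa only [sub_mul, smul_mul_assoc] using congrArg (· * r) (h n m)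

end QuadraticRel

/-! ### Serre relations -/

variable {s : ℂ} {a b : ℤ → R}

theorem serre_inv (q : ℂ) (x y : ℤ → R) : serre q⁻¹ x y = serre q x y := by
  funext i j k
  simp only [serre, serreHalf, inv_inv, add_comm q⁻¹]

theorem map_serre {R' : Type*} [Ring R'] [Algebra ℂ R'] (φ : R →ₐ[ℂ] R') (q : ℂ) (x y : ℤ → R)
    (i j k : ℤ) : φ (serre q x y i j k) = serre q (fun n => φ (x n)) (fun n => φ (y n)) i j k := by
  simp only [serre, serreHalf, map_add, map_sub, map_mul, map_smul]

theorem smul_serre (hs : s ≠ 0) (x y : ℤ → R) (i j k : ℤ) :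
    s • serre s x y i j k =
      (s • (x i * x j * y k) - (s ^ 2 + 1) • (x i * y k * x j) + s • (y k * x i * x j)) +
      (s • (x j * x i * y k) - (s ^ 2 + 1) • (x j * y k * x i) + s • (y k * x j * x i)) := by
  rw [serre, serreHalf, serreHalf, show s ^ 2 + 1 = s * (s + s⁻¹) by field_simp]
  module

theorem binomialMul_binomialMul_serre_left (hs : s ≠ 0) (hab : QuadraticRel s a b)
    (haa : QuadraticRel (s ^ 2)⁻¹ a a) (i j k : ℤ) :
    binomialMul 1 s (fun i k => binomialMul 1 s (fun j k => serre s a b i j k) j k) i k = 0 := by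
  apply smul_right_injective R hs
  simp only [binomialMul]
  have h_serre := smul_serre hs a b
  have h_last (i j k : ℤ) := hab.mul_left (a i) j k
  have h_first (i j k : ℤ) := hab.mul_right (a j) i k
  have h_self := congrArg (b (k + 1) * ·) (haa.inv_smul (pow_ne_zero 2 hs) i j)
  simp only [mul_sub, mul_smul_comm, ← mul_assoc] at h_self
  linear_combination (norm := module)
    h_serre (i + 1) (j + 1) k - s • h_serre i (j + 1) (k + 1)
    - s • (h_serre (i + 1) j (k + 1) - s • h_serre i j (k + 1 + 1))
    + s • (h_last (i + 1) j k - s • h_last i j (k + 1))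
    + s • (h_last (j + 1) i k - s • h_last j i (k + 1))
    + s • (s • h_first i (j + 1) k - h_first i j (k + 1))
    + s • (s • h_first j (i + 1) k - h_first j i (k + 1))
    - (s ^ 2 + 1) • (h_first i (j + 1) k - s • h_first i j (k + 1))
    - (s ^ 2 + 1) • (h_first j (i + 1) k - s • h_first j i (k + 1))
    + (s ^ 2 - 1) • h_self

theorem binomialMul_binomialMul_serre_right (hs : s ≠ 0) (hab : QuadraticRel s a b)
    (hbb : QuadraticRel (s ^ 2)⁻¹ b b) (i j k : ℤ) :
    binomialMul s 1 (fun i k => binomialMul s 1 (fun j k => serre s b a i j k) j k) i k = 0 := by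
  apply smul_right_injective R hs
  simp only [binomialMul]
  have h_serre := smul_serre hs b a
  have h_last (i j k : ℤ) := hab.mul_left (b i) k j
  have h_first (i j k : ℤ) := hab.mul_right (b j) k i
  have h_self := congrArg (· * a (k + 1)) (hbb.inv_smul (pow_ne_zero 2 hs) j i)
  simp only [sub_mul, smul_mul_assoc] at h_self
  linear_combination (norm := module)
    h_serre i j (k + 1 + 1) - s • h_serre (i + 1) j (k + 1)
    - s • (h_serre i (j + 1) (k + 1) - s • h_serre (i + 1) (j + 1) k)
    + s • (h_first i j (k + 1) - s • h_first i (j + 1) k)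
    + s • (h_first j i (k + 1) - s • h_first j (i + 1) k)
    + s • (s • h_last i j (k + 1) - h_last (i + 1) j k)
    + s • (s • h_last j i (k + 1) - h_last (j + 1) i k)
    - (s ^ 2 + 1) • (h_last i j (k + 1) - s • h_last (i + 1) j k)
    - (s ^ 2 + 1) • (h_last j i (k + 1) - s • h_last (j + 1) i k)
    + (s ^ 2 - 1) • h_self

end Quadratic

/-! ### Smooth and restricted currents -/

section Smooth

variable {V : Type*} [AddCommGroup V]

/-- Currents `X(z) = ∑ X_n z^{-n}` as on a highest weight representation: on each vector `X(z)` has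
finitely many terms with `n > 0`. -/
structure IsSmooth (X : ℤ → V → V) : Prop where
  map_zero : ∀ n, X n 0 = 0
  eventually_zero : ∀ v, ∃ N, ∀ n ≥ N, X n v = 0

variable {X Y : ℤ → V → V}

theorem IsSmooth.exists_comp_eq_zero (hX : IsSmooth X) (hY : ∀ m, Y m 0 = 0) (v : V) :
    ∃ N, ∀ n ≥ N, ∀ m, Y m (X n v) = 0 := by
  obtain ⟨N, hN⟩ := hX.eventually_zero v
  exact ⟨N, fun n hn m => by rw [hN n hn, hY]⟩

theorem IsSmooth.exists_forall_comp_eq_zero (hX : IsSmooth X) (v : V) (j : ℤ) :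
    ∃ M, ∀ i ≥ M, ∀ n ≥ j, X i (X n v) = 0 := by
  obtain ⟨N, hN⟩ := hX.eventually_zero v
  have h_finite : ∀ᶠ i in Filter.atTop, ∀ n ∈ Set.Ico j N, X i (X n v) = 0 :=
    (Set.finite_Ico j N).eventually_all.2 fun n _ =>
      Filter.eventually_atTop.2 (hX.eventually_zero (X n v))
  obtain ⟨M, hM⟩ := Filter.eventually_atTop.1 h_finite
  refine ⟨M, fun i hi n hn => ?_⟩
  by_cases hnN : n < N
  · exact hM i hi n ⟨hn, hnN⟩
  · rw [hN n (not_lt.1 hnN), hX.map_zero]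

variable [Module ℂ V]

/-- The current with modes `a n`, as a family of maps. -/
abbrev modes (a : ℤ → Module.End ℂ V) (n : ℤ) : V → V := a n

/-- Functionals for which the currents `⟨ξ, X(z) v⟩` have their terms with `n < 0` bounded uniformly
in `v`, as for the restricted dual of a highest weight representation. -/
def IsRestrictedFor (ξ : V →ₗ[ℂ] ℂ) (X : ℤ → V → V) : Prop :=
  ∃ N, ∀ n ≤ N, ∀ v, ξ (X n v) = 0

variable {ξ : V →ₗ[ℂ] ℂ}

theorem IsSmooth.smul (hX : IsSmooth X) (w : ℤ → ℂ) : IsSmooth fun n v => w n • X n v where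
  map_zero n := by rw [hX.map_zero, smul_zero]
  eventually_zero v := (hX.eventually_zero v).imp fun N hN n hn => by rw [hN n hn, smul_zero]

theorem IsRestrictedFor.smul (hX : IsRestrictedFor ξ X) (w : ℤ → ℂ) :
    IsRestrictedFor ξ fun n v => w n • X n v :=
  hX.imp fun N hN n hn v => by rw [map_smul, hN n hn, smul_zero]

end Smooth

/-! ### The fused current of a pair of currents -/

section Fused

variable {V : Type*} [AddCommGroup V] [Module ℂ V] {s : ℂ} {a b : ℤ → Module.End ℂ V}

/-- The modes of the current `C(y)` with
`a(x) b(y) = C(y) δ(s y / x) + (s x - y)/(x - s y) b(y) a(x)`, where the fraction is expanded for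
`|x| < |s y|`. -/
def fused (s : ℂ) (a b : ℤ → Module.End ℂ V) (m : ℤ) (v : V) : V :=
  a 0 (b m v) - continued s (modes a) (modes b) 0 m v

theorem continued_eq_zero {v : V} {n : ℤ} (h : ∀ k ≥ n, a k v = 0) (m : ℤ) :
    continued s (modes a) (modes b) n m v = 0 :=
  seriesMul_eq_zero _ fun k => by
    change b _ (a _ v) = 0
    rw [h _ (by omega), map_zero]

theorem binomialMul_continued (hs : s ≠ 0) (ha : IsSmooth (modes a)) (v : V) (n m : ℤ) :
    binomialMul 1 s (fun n m => continued s (modes a) (modes b) n m v) n m =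
      binomialMul s 1 (fun n m => b m (a n v)) n m := by
  obtain ⟨N, hN⟩ := ha.exists_comp_eq_zero (Y := modes b) (fun m => map_zero (b m)) v
  exact binomialMul_seriesMul_ratio s 1 1 hs hN n m

theorem mul_apply_eq_fused_add_continued (hs : s ≠ 0) (hab : QuadraticRel s a b)
    (ha : IsSmooth (modes a)) (n m : ℤ) (v : V) :
    a n (b m v) = s ^ n • fused s a b (n + m) v + continued s (modes a) (modes b) n m v := by
  have h_rec (n m : ℤ) :
      binomialMul 1 s (fun n m => a n (b m v) - continued s (modes a) (modes b) n m v) n m = 0 := by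
    have h_mul := LinearMap.congr_fun (hab n m) v
    simp only [LinearMap.sub_apply, LinearMap.smul_apply, Module.End.mul_apply] at h_mul
    rw [binomialMul_sub, binomialMul_continued hs ha]
    simp only [binomialMul]
    linear_combination (norm := module) h_mul
  have h_delta := eq_zpow_smul_of_binomialMul_eq_zero one_ne_zero hs h_rec n m
  rw [div_one] at h_delta
  rw [fused, ← h_delta, sub_add_cancel]

theorem zpow_smul_fused (hs : s ≠ 0) (hab : QuadraticRel s a b) (ha : IsSmooth (modes a))
    (n m : ℤ) (v : V) :
    s ^ n • fused s a b m v = a n (b (m - n) v) - continued s (modes a) (modes b) n (m - n) v := by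
  rw [mul_apply_eq_fused_add_continued hs hab ha n (m - n) v, add_sub_cancel, add_sub_cancel_right]

theorem fused_zero (m : ℤ) : fused s a b m 0 = 0 := by
  rw [fused, continued_eq_zero fun k _ => map_zero (a k), map_zero, map_zero, sub_zero]

theorem isSmooth_fused (hs : s ≠ 0) (hab : QuadraticRel s a b) (ha : IsSmooth (modes a))
    (hb : IsSmooth (modes b)) : IsSmooth (fused s a b) where
  map_zero := fused_zero
  eventually_zero v := by
    obtain ⟨N, hN⟩ := ha.eventually_zero v
    obtain ⟨M, hM⟩ := hb.eventually_zero v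
    refine ⟨N + M, fun n hn => ?_⟩
    rw [← smul_eq_zero_iff_right (zpow_ne_zero N hs), zpow_smul_fused hs hab ha,
      show b (n - N) v = 0 from hM _ (by omega), continued_eq_zero hN, map_zero, sub_zero]

theorem isRestrictedFor_fused (hs : s ≠ 0) (hab : QuadraticRel s a b) (ha : IsSmooth (modes a))
    {ξ : V →ₗ[ℂ] ℂ} (hξa : IsRestrictedFor ξ (modes a)) (hξb : IsRestrictedFor ξ (modes b)) :
    IsRestrictedFor ξ (fused s a b) := by
  obtain ⟨N, hN⟩ := hξa
  obtain ⟨M, hM⟩ := hξb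
  refine ⟨N + M, fun n hn v => ?_⟩
  obtain ⟨B, hB⟩ := ha.exists_comp_eq_zero (Y := modes b) (fun m => map_zero (b m)) v
  have h_continued : ξ (continued s (modes a) (modes b) N (n - N) v) = 0 :=
    (map_seriesMul ξ _ hB _ _).trans <| finsum_eq_zero_of_forall_eq_zero fun k => by
      rw [hM _ (by omega), smul_zero]
  rw [← smul_eq_zero_iff_right (zpow_ne_zero N hs), ← map_smul, zpow_smul_fused hs hab ha, map_sub,
    h_continued, show ξ (a N _) = 0 from hN N le_rfl _, sub_zero]

/-! ### The Serre relation as an exchange relation -/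

/-- The coefficients of `a(x) C(y) - (s⁻¹ x - s² y)/(x - s y) C(y) a(x)`, `C` the fused current. -/
def leftDefect (s : ℂ) (a b : ℤ → Module.End ℂ V) (v : V) (n m : ℤ) : V :=
  a n (fused s a b m v) -
    seriesMul (ratio s⁻¹ (s ^ 2) 1 s) (fun n m u => fused s a b m (a n u)) n m v

/-- The coefficients of `C(x) b(y) - (x - s² y)/(s x - s y) b(y) C(x)`, `C` the fused current. -/
def rightDefect (s : ℂ) (a b : ℤ → Module.End ℂ V) (v : V) (n m : ℤ) : V :=
  fused s a b n (b m v) -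
    seriesMul (ratio 1 (s ^ 2) s s) (fun n m u => b m (fused s a b n u)) n m v

/-- What remains of half of the Serre expression when the delta function terms, which carry the
fused current, are removed. -/
def leftRemainder (s : ℂ) (a b : ℤ → Module.End ℂ V) (v : V) (i j k : ℤ) : V :=
  serreHalf s a b i j k v - s ^ j • a i (fused s a b (j + k) v) +
    s ^ i • seriesMul (ratio s⁻¹ (s ^ 2) 1 s) (fun n m u => fused s a b m (a n u)) j (i + k) v

/-- The analogue of `leftRemainder` for the Serre expression that is quadratic in `b`. -/
def rightRemainder (s : ℂ) (a b : ℤ → Module.End ℂ V) (v : V) (i j k : ℤ) : V :=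
  serreHalf s b a i j k v - s ^ k • fused s a b (k + i) (b j v) +
    s ^ k • seriesMul (ratio 1 (s ^ 2) s s) (fun n m u => b m (fused s a b n u)) (k + j) i v

theorem serreHalf_apply (q : ℂ) (x y : ℤ → Module.End ℂ V) (i j k : ℤ) (v : V) :
    serreHalf q x y i j k v =
      x i (x j (y k v)) - (q + q⁻¹) • x i (y k (x j v)) + y k (x i (x j v)) := rfl

theorem leftRemainder_add_swap (i j k : ℤ) (v : V) :
    leftRemainder s a b v i j k + leftRemainder s a b v j i k =
      serre s a b i j k v - s ^ j • leftDefect s a b v i (j + k)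
        - s ^ i • leftDefect s a b v j (i + k) := by
  rw [serre, LinearMap.add_apply, leftRemainder, leftRemainder, leftDefect, leftDefect]
  module

theorem rightRemainder_add_swap (i j k : ℤ) (v : V) :
    rightRemainder s a b v i j k + rightRemainder s a b v j i k =
      serre s b a i j k v - s ^ k • rightDefect s a b v (k + i) j
        - s ^ k • rightDefect s a b v (k + j) i := by
  rw [serre, LinearMap.add_apply, rightRemainder, rightRemainder, rightDefect, rightDefect]
  module

theorem apply_mul_apply_eq (hs : s ≠ 0) (hab : QuadraticRel s a b) (ha : IsSmooth (modes a))
    (i j k : ℤ) (v : V) :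
    a i (a j (b k v)) = s ^ j • a i (fused s a b (j + k) v) +
      seriesMul (ratio s 1 1 s) (fun n m u => a i (b m (a n u))) j k v := by
  obtain ⟨N, hN⟩ := ha.exists_comp_eq_zero (Y := modes b) (fun m => map_zero (b m)) v
  rw [mul_apply_eq_fused_add_continued hs hab ha j k v, map_add, map_smul]
  exact congrArg _ (map_seriesMul (a i) _ hN j k)

theorem leftRemainder_eq (hs : s ≠ 0) (hab : QuadraticRel s a b) (ha : IsSmooth (modes a))
    (v : V) (i j k : ℤ) :
    leftRemainder s a b v i j k =
      seriesMul (ratio s 1 1 s) (fun n m u => continued s (modes a) (modes b) i m (a n u)) j k v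
        - (s + s⁻¹) • continued s (modes a) (modes b) i k (a j v) + b k (a i (a j v)) := by
  obtain ⟨N, hN⟩ := ha.eventually_zero v
  have h_bound {T : ℤ → ℤ → V → V} (hT : ∀ n m, T n m 0 = 0) :
      ∀ n ≥ N, ∀ m, T n m (a n v) = 0 := fun n hn m => by
    rw [show a n v = 0 from hN n hn, hT]
  have h_fused := h_bound (T := fun _ m u => fused s a b m u) fun _ m => fused_zero m
  have h_continued := h_bound (T := fun _ m u => continued s (modes a) (modes b) i m u)
    fun _ m => continued_eq_zero (fun k _ => map_zero (a k)) m
  have h_triple := h_bound (T := fun _ m u => a i (b m u)) fun _ m => by simp only [map_zero]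
  have h_split : seriesMul (ratio s 1 1 s) (fun n m u => a i (b m (a n u))) j k v =
      s ^ i • seriesMul (ratio s 1 1 s) (fun n m u => fused s a b m (a n u)) j (i + k) v +
        seriesMul (ratio s 1 1 s) (fun n m u => continued s (modes a) (modes b) i m (a n u))
          j k v := by
    have hK : N ≤ j + (N - j).toNat := by omega
    rw [seriesMul_eq_sum_of_bound _ h_triple hK, seriesMul_eq_sum_of_bound _ h_fused hK,
      seriesMul_eq_sum_of_bound _ h_continued hK, Finset.smul_sum, ← Finset.sum_add_distrib]
    refine Finset.sum_congr rfl fun l _ => ?_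
    rw [mul_apply_eq_fused_add_continued hs hab ha i, add_sub_assoc]
    module
  rw [leftRemainder, ratio_inv_sq_one_self hs, seriesMul_sub _ _ h_fused, seriesMul_C,
    serreHalf_apply, apply_mul_apply_eq hs hab ha, h_split,
    mul_apply_eq_fused_add_continued hs hab ha i k (a j v)]
  module

theorem eventually_leftRemainder_eq_zero (hs : s ≠ 0) (hab : QuadraticRel s a b)
    (ha : IsSmooth (modes a)) (v : V) (j : ℤ) :
    ∀ᶠ i in Filter.atTop, ∀ k, leftRemainder s a b v i j k = 0 := by
  obtain ⟨M, hM⟩ := ha.exists_forall_comp_eq_zero v j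
  filter_upwards [Filter.eventually_ge_atTop M] with i hi k
  have h_continued {n : ℤ} (hn : n ≥ j) (m : ℤ) :
      continued s (modes a) (modes b) i m (a n v) = 0 :=
    continued_eq_zero (fun l hl => hM l (hi.trans hl) n hn) m
  rw [leftRemainder_eq hs hab ha, seriesMul_eq_zero _ fun l => h_continued (by omega) _,
    h_continued le_rfl, show a i (a j v) = 0 from hM i hi j le_rfl, smul_zero, map_zero, sub_zero,
    add_zero]

theorem eventually_leftRemainder_swap_eq_zero (hs : s ≠ 0) (hab : QuadraticRel s a b)
    (ha : IsSmooth (modes a)) (v : V) (i : ℤ) :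
    ∀ᶠ j in Filter.atTop, ∀ k, leftRemainder s a b v i j k = 0 := by
  obtain ⟨N, hN⟩ := ha.eventually_zero v
  filter_upwards [Filter.eventually_ge_atTop N] with j hj k
  have h_continued (n m : ℤ) : continued s (modes a) (modes b) n m 0 = 0 :=
    continued_eq_zero (fun l _ => map_zero (a l)) m
  have h_zero {n : ℤ} (hn : n ≥ j) : a n v = 0 := hN n (hj.trans hn)
  rw [leftRemainder_eq hs hab ha, seriesMul_eq_zero _ fun l => by
      rw [h_zero (by omega), h_continued],
    h_zero le_rfl, h_continued, map_zero, map_zero, smul_zero, sub_zero, add_zero]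

theorem serre_apply_eq_leftDefect (hs : s ≠ 0) (hab : QuadraticRel s a b)
    (haa : QuadraticRel (s ^ 2)⁻¹ a a) (ha : IsSmooth (modes a)) (i j k : ℤ) (v : V) :
    serre s a b i j k v =
      s ^ j • leftDefect s a b v i (j + k) + s ^ i • leftDefect s a b v j (i + k) := by
  have h_zero := eq_zero_of_binomialMul_binomialMul_eq_zero one_ne_zero hs
    (W := fun i j k => leftRemainder s a b v i j k + leftRemainder s a b v j i k)
    (l := Filter.atTop) (fun i j k => add_comm _ _)
    (fun j t => by
      filter_upwards [eventually_leftRemainder_eq_zero hs hab ha v j,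
        eventually_leftRemainder_swap_eq_zero hs hab ha v j] with i h₁ h₂
      rw [h₁, h₂, add_zero])
    (fun i j k => by
      have h_serre := LinearMap.congr_fun
        (binomialMul_binomialMul_serre_left hs hab haa i j k) v
      simp only [binomialMul, LinearMap.sub_apply, LinearMap.smul_apply,
        LinearMap.zero_apply] at h_serre
      simp only [binomialMul, leftRemainder_add_swap, zpow_add_one₀ hs, add_right_comm _ (1 : ℤ),
        ← add_assoc]
      linear_combination (norm := module) h_serre) i j k
  rw [leftRemainder_add_swap] at h_zero
  linear_combination (norm := module) h_zero

theorem rightRemainder_eq_zero (hs : s ≠ 0) (hab : QuadraticRel s a b) (ha : IsSmooth (modes a))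
    {v : V} {k : ℤ} (hk : ∀ n ≥ k, a n v = 0) (i j : ℤ) : rightRemainder s a b v i j k = 0 := by
  have h_fused {n : ℤ} (hn : n ≥ k) : s ^ n • fused s a b (n + j) v = a n (b j v) := by
    rw [mul_apply_eq_fused_add_continued hs hab ha n j v,
      continued_eq_zero fun l hl => hk l (hn.trans hl), add_zero]
  have h_series : s ^ k • seriesMul (ratio 1 (s ^ 2) s s) (fun n m u => b m (fused s a b n u))
      (k + j) i v = seriesMul (ratio s⁻¹ (s ^ 2) 1 s) (fun n m u => b m (a n u)) k i (b j v) := by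
    have h_rescale := rescale_ratio (a := s⁻¹) (b := s ^ 2) (c := 1) hs s
    rw [inv_mul_cancel₀ hs, one_mul] at h_rescale
    rw [← h_rescale]
    simp only [seriesMul, smul_finsum, PowerSeries.coeff_rescale]
    refine finsum_congr fun l => ?_
    rw [← h_fused (n := k + l) (by omega), map_smul, zpow_add₀ hs, zpow_natCast, add_right_comm]
    module
  obtain ⟨M, hM⟩ := ha.exists_comp_eq_zero (Y := modes b) (fun m => map_zero (b m)) (b j v)
  have h_mul : a k (b i (b j v)) = s ^ k • fused s a b (k + i) (b j v) +
      seriesMul (ratio s 1 1 s) (fun n m u => b m (a n u)) k i (b j v) :=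
    mul_apply_eq_fused_add_continued hs hab ha k i (b j v)
  rw [rightRemainder, serreHalf_apply, h_series, ratio_inv_sq_one_self hs, seriesMul_sub _ _ hM,
    seriesMul_C, hk k le_rfl, h_mul, map_zero, map_zero]
  module

theorem serre_apply_eq_rightDefect (hs : s ≠ 0) (hab : QuadraticRel s a b)
    (hbb : QuadraticRel (s ^ 2)⁻¹ b b) (ha : IsSmooth (modes a)) (i j k : ℤ) (v : V) :
    serre s b a i j k v =
      s ^ k • rightDefect s a b v (k + i) j + s ^ k • rightDefect s a b v (k + j) i := by
  obtain ⟨N, hN⟩ := ha.eventually_zero v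
  have h_zero := eq_zero_of_binomialMul_binomialMul_eq_zero hs one_ne_zero
    (W := fun i j k => rightRemainder s a b v i j k + rightRemainder s a b v j i k)
    (l := Filter.atBot) (fun i j k => add_comm _ _)
    (fun j t => by
      filter_upwards [Filter.eventually_le_atBot (t - N)] with i hi
      have h_large : ∀ n ≥ t - i, a n v = 0 := fun n hn => hN n (by omega)
      rw [rightRemainder_eq_zero hs hab ha h_large, rightRemainder_eq_zero hs hab ha h_large,
        add_zero])
    (fun i j k => by
      have h_serre := LinearMap.congr_fun
        (binomialMul_binomialMul_serre_right hs hab hbb i j k) v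
      simp only [binomialMul, LinearMap.sub_apply, LinearMap.smul_apply,
        LinearMap.zero_apply] at h_serre
      simp only [binomialMul, rightRemainder_add_swap, zpow_add_one₀ hs,
        add_right_comm _ (1 : ℤ), ← add_assoc]
      linear_combination (norm := module) h_serre) i j k
  rw [rightRemainder_add_swap] at h_zero
  linear_combination (norm := module) h_zero

theorem serre_eq_zero_iff_exchange_left (hs : s ≠ 0) (hab : QuadraticRel s a b)
    (haa : QuadraticRel (s ^ 2)⁻¹ a a) (ha : IsSmooth (modes a)) :
    (∀ i j k, serre s a b i j k = 0) ↔
      Exchange s⁻¹ (s ^ 2) 1 s (modes a) (fused s a b) := by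
  constructor
  · intro h_serre n m v
    have h_defect := serre_apply_eq_leftDefect hs hab haa ha n n (m - n) v
    rw [h_serre, LinearMap.zero_apply, add_sub_cancel, ← two_smul ℂ, smul_smul, eq_comm,
      smul_eq_zero_iff_right (mul_ne_zero two_ne_zero (zpow_ne_zero _ hs))] at h_defect
    exact sub_eq_zero.1 h_defect
  · intro h_exchange i j k
    have h_defect (v : V) (n m : ℤ) : leftDefect s a b v n m = 0 :=
      sub_eq_zero.2 (h_exchange n m v)
    ext v
    rw [serre_apply_eq_leftDefect hs hab haa ha, h_defect, h_defect, smul_zero, smul_zero, add_zero,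
      LinearMap.zero_apply]

theorem serre_eq_zero_iff_exchange_right (hs : s ≠ 0) (hab : QuadraticRel s a b)
    (hbb : QuadraticRel (s ^ 2)⁻¹ b b) (ha : IsSmooth (modes a)) :
    (∀ i j k, serre s b a i j k = 0) ↔
      Exchange 1 (s ^ 2) s s (fused s a b) (modes b) := by
  constructor
  · intro h_serre n m v
    have h_defect := serre_apply_eq_rightDefect hs hab hbb ha m m (n - m) v
    rw [h_serre, LinearMap.zero_apply, sub_add_cancel, ← two_smul ℂ, smul_smul, eq_comm,
      smul_eq_zero_iff_right (mul_ne_zero two_ne_zero (zpow_ne_zero _ hs))] at h_defect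
    exact sub_eq_zero.1 h_defect
  · intro h_exchange i j k
    have h_defect (v : V) (n m : ℤ) : rightDefect s a b v n m = 0 :=
      sub_eq_zero.2 (h_exchange n m v)
    ext v
    rw [serre_apply_eq_rightDefect hs hab hbb ha, h_defect, h_defect, smul_zero, add_zero,
      LinearMap.zero_apply]

end Fused

/-! ### Laurent series of rational functions in two variables -/

section Laurent

variable {𝕜 : Type*} [NormedField 𝕜] {T P : ℤ → ℤ → 𝕜} {c d z w : 𝕜}

/-- The term of index `p` of the Laurent series `∑ T n m z^{-n} w^{-m}`. -/
def laurentTerm (T : ℤ → ℤ → 𝕜) (z w : 𝕜) (p : ℤ × ℤ) : 𝕜 := T p.1 p.2 * z ^ (-p.1) * w ^ (-p.2)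

/-- The array `P` consists of the coefficients of a Laurent polynomial in two variables. -/
def IsLaurentPolynomial (P : ℤ → ℤ → 𝕜) : Prop := {p : ℤ × ℤ | P p.1 p.2 ≠ 0}.Finite

/-- The sum of the Laurent series with coefficients `P`; it is used for Laurent polynomials, as
their value at a point. -/
def laurentSum (P : ℤ → ℤ → 𝕜) (z w : 𝕜) : 𝕜 := ∑' p, laurentTerm P z w p

theorem isLaurentPolynomial_of_bounds {N₁ N₂ M₁ M₂ : ℤ} (h_le_left : ∀ n ≤ N₁, ∀ m, P n m = 0)
    (h_ge_left : ∀ n ≥ N₂, ∀ m, P n m = 0) (h_le_right : ∀ m ≤ M₁, ∀ n, P n m = 0)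
    (h_ge_right : ∀ m ≥ M₂, ∀ n, P n m = 0) : IsLaurentPolynomial P := by
  refine ((Set.finite_Icc N₁ N₂).prod (Set.finite_Icc M₁ M₂)).subset fun p hp => ?_
  by_contra h_not_mem
  simp only [Set.mem_prod, Set.mem_Icc, not_and_or, not_le] at h_not_mem
  rcases h_not_mem with (h | h) | (h | h)
  exacts [hp (h_le_left _ h.le _), hp (h_ge_left _ h.le _), hp (h_le_right _ h.le _),
    hp (h_ge_right _ h.le _)]

theorem IsLaurentPolynomial.neg_swap (hP : IsLaurentPolynomial P) :
    IsLaurentPolynomial fun m n => -P n m :=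
  (hP.preimage Prod.swap_injective.injOn).subset fun _ => neg_ne_zero.1

theorem IsLaurentPolynomial.binomialMul (hP : IsLaurentPolynomial P) (c d : 𝕜) :
    IsLaurentPolynomial (binomialMul c d P) := by
  have h_left := hP.preimage (f := fun p : ℤ × ℤ => (p.1 + 1, p.2)) fun p _ p' _ h => by
    simpa [Prod.ext_iff] using h
  have h_right := hP.preimage (f := fun p : ℤ × ℤ => (p.1, p.2 + 1)) fun p _ p' _ h => by
    simpa [Prod.ext_iff] using h
  refine (h_left.union h_right).subset fun p hp => ?_
  by_contra h
  simp_all [DrinfeldCurrent.binomialMul]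

theorem IsLaurentPolynomial.hasSum (hP : IsLaurentPolynomial P) (z w : 𝕜) :
    HasSum (laurentTerm P z w) (laurentSum P z w) :=
  (summable_of_hasFiniteSupport <| hP.subset fun p hp h => hp (by simp [laurentTerm, h])).hasSum

theorem IsLaurentPolynomial.laurentSum_eq (hP : IsLaurentPolynomial P) (z w : 𝕜) :
    laurentSum P z w = ∑ p ∈ hP.toFinset, laurentTerm P z w p :=
  tsum_eq_sum fun p hp => by
    rw [hP.mem_toFinset, Set.mem_ofPred_eq, not_not] at hp
    rw [laurentTerm, hp, zero_mul, zero_mul]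

theorem hasSum_laurentTerm_binomialMul (hz : z ≠ 0) (hw : w ≠ 0) {F : 𝕜}
    (hT : HasSum (laurentTerm T z w) F) (c d : 𝕜) :
    HasSum (laurentTerm (binomialMul c d T) z w) ((c * z - d * w) * F) := by
  have h_left := ((Equiv.addRight ((1 : ℤ), (0 : ℤ))).hasSum_iff.2 hT).mul_left (c * z)
  have h_right := ((Equiv.addRight ((0 : ℤ), (1 : ℤ))).hasSum_iff.2 hT).mul_left (d * w)
  rw [sub_mul]
  refine (h_left.sub h_right).congr_fun fun p => ?_
  simp only [laurentTerm, binomialMul, smul_eq_mul, Function.comp_apply, Equiv.coe_addRight,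
    Prod.fst_add, Prod.snd_add, add_zero, neg_add, zpow_add₀ hz, zpow_add₀ hw, zpow_neg_one]
  field_simp

/-- The expansion of `z^{-i} w^{-j} / (c z - d w)` in the region `|d w| < |c z|`. -/
def elementary (c d : 𝕜) (i j n m : ℤ) : 𝕜 :=
  if n + m = i + j + 1 ∧ i < n then c⁻¹ * (d / c) ^ (n - i - 1) else 0

theorem binomialMul_elementary (hc : c ≠ 0) (hd : d ≠ 0) (i j n m : ℤ) :
    binomialMul c d (elementary c d i j) n m = if (n, m) = (i, j) then 1 else 0 := by
  simp only [binomialMul, elementary, smul_eq_mul, Prod.mk.injEq]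
  by_cases h_diag : n + m = i + j
  · rcases lt_trichotomy i n with hn | rfl | hn
    · rw [if_pos ⟨by omega, by omega⟩, if_pos ⟨by omega, hn⟩, if_neg (by omega),
        show n + 1 - i - 1 = n - i - 1 + 1 by ring, zpow_add_one₀ (div_ne_zero hd hc)]
      field_simp
      ring
    · rw [if_pos ⟨by omega, by omega⟩, if_neg (by omega), if_pos ⟨rfl, by omega⟩]
      simp [hc]
    · rw [if_neg (by omega), if_neg (by omega), if_neg (by omega)]
      simp
  · rw [if_neg (by omega), if_neg (by omega), if_neg (by omega)]
    simp

theorem summable_laurentTerm_elementary (hc : c ≠ 0) (hz : z ≠ 0) (hw : w ≠ 0)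
    (h_lt : ‖d * w‖ < ‖c * z‖) (i j : ℤ) : Summable (laurentTerm (elementary c d i j) z w) := by
  have h_inj : Function.Injective fun k : ℕ => ((i + 1 + k, j - k) : ℤ × ℤ) := fun k l h => by
    simpa using h
  rw [← h_inj.summable_iff]
  · have h_norm : ‖d * w / (c * z)‖ < 1 := by
      rwa [norm_div, div_lt_one (norm_pos_iff.2 (mul_ne_zero hc hz))]
    have h_geom : Summable fun k : ℕ => (d * w / (c * z)) ^ k :=
      (hasSum_geometric_of_norm_lt_one h_norm).summable
    refine (h_geom.mul_left (z ^ (-i) * w ^ (-j) / (c * z))).congr fun k => ?_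
    simp only [Function.comp_apply, laurentTerm, elementary]
    rw [if_pos ⟨by ring, by omega⟩, show i + 1 + (k : ℤ) - i - 1 = k by ring,
      show -(i + 1 + (k : ℤ)) = -i + -1 + -k by ring, show -(j - (k : ℤ)) = -j + k by ring,
      zpow_add₀ hz, zpow_add₀ hz, zpow_add₀ hw, zpow_neg z k]
    simp only [zpow_natCast, zpow_neg_one, div_pow, mul_pow]
    field_simp
  · rintro ⟨n, m⟩ h_not_mem
    rw [laurentTerm, elementary, if_neg, zero_mul, zero_mul]
    rintro ⟨h_diag, h_lt⟩
    refine h_not_mem ⟨(n - i - 1).toNat, ?_⟩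
    simp only [Prod.mk.injEq] at h_diag h_lt ⊢
    omega

theorem eq_sum_elementary (hc : c ≠ 0) (hd : d ≠ 0) (hT : IsLaurentPolynomial (binomialMul c d T))
    {N : ℤ} (hN : ∀ n ≤ N, ∀ m, T n m = 0) (n m : ℤ) :
    T n m = ∑ p ∈ hT.toFinset, binomialMul c d T p.1 p.2 * elementary c d p.1 p.2 n m := by
  set R : ℤ → ℤ → 𝕜 := fun n m =>
    ∑ p ∈ hT.toFinset, binomialMul c d T p.1 p.2 * elementary c d p.1 p.2 n m with hR
  have h_binomial : ∀ n m, binomialMul c d R n m = binomialMul c d T n m := fun n m => by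
    have h_swap : binomialMul c d R n m = ∑ p ∈ hT.toFinset,
        binomialMul c d T p.1 p.2 * binomialMul c d (elementary c d p.1 p.2) n m := by
      simp only [hR, binomialMul, smul_eq_mul, Finset.mul_sum, ← Finset.sum_sub_distrib]
      exact Finset.sum_congr rfl fun p _ => by ring
    simp only [h_swap, binomialMul_elementary hc hd, Prod.mk.eta, mul_ite, mul_one, mul_zero]
    rw [Finset.sum_ite_eq, ite_eq_left_iff, hT.mem_toFinset, Set.mem_ofPred_eq, not_not]
    exact Eq.symm
  refine sub_eq_zero.1 <| eq_zero_of_binomialMul_eq_zero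
    (S := fun n m => T n m - R n m) hc hd (fun n m => ?_) (fun t => ?_) n m
  · rw [binomialMul_sub, h_binomial, sub_self]
  · obtain ⟨N', hN'⟩ := (hT.image Prod.fst).bddBelow
    refine ⟨min N N', ?_⟩
    rw [hN _ (min_le_left _ _), zero_sub, neg_eq_zero]
    refine Finset.sum_eq_zero fun p hp => ?_
    have h_le : N' ≤ p.1 := hN' ⟨p, hT.mem_toFinset.1 hp, rfl⟩
    rw [elementary, if_neg fun h => (h.2.trans_le (min_le_right _ _)).not_ge h_le, mul_zero]

theorem summable_of_norm_lt (hc : c ≠ 0) (hd : d ≠ 0)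
    (hT : IsLaurentPolynomial (binomialMul c d T)) {N : ℤ} (hN : ∀ n ≤ N, ∀ m, T n m = 0)
    (hz : z ≠ 0) (hw : w ≠ 0) (h_lt : ‖d * w‖ < ‖c * z‖) : Summable (laurentTerm T z w) := by
  refine (summable_sum fun (p : ℤ × ℤ) (_ : p ∈ hT.toFinset) =>
    (summable_laurentTerm_elementary hc hz hw h_lt p.1 p.2).mul_left
      (binomialMul c d T p.1 p.2)).congr fun p => ?_
  rw [laurentTerm, eq_sum_elementary hc hd hT hN, Finset.sum_mul, Finset.sum_mul]
  exact Finset.sum_congr rfl fun p _ => by rw [laurentTerm]; ring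

theorem hasSum_div_of_summable (hT : Summable (laurentTerm T z w)) (hz : z ≠ 0) (hw : w ≠ 0)
    (h_ne : c * z ≠ d * w) :
    HasSum (laurentTerm T z w) (laurentSum (binomialMul c d T) z w / (c * z - d * w)) := by
  have h_eq := (hasSum_laurentTerm_binomialMul hz hw hT.hasSum c d).tsum_eq
  rw [laurentSum, h_eq, mul_div_cancel_left₀ _ (sub_ne_zero.2 h_ne)]
  exact hT.hasSum

theorem hasSum_div_of_norm_lt (hc : c ≠ 0) (hd : d ≠ 0)
    (hT : IsLaurentPolynomial (binomialMul c d T)) {N : ℤ} (hN : ∀ n ≤ N, ∀ m, T n m = 0)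
    (hz : z ≠ 0) (hw : w ≠ 0) (h_lt : ‖d * w‖ < ‖c * z‖) :
    HasSum (laurentTerm T z w) (laurentSum (binomialMul c d T) z w / (c * z - d * w)) :=
  hasSum_div_of_summable (summable_of_norm_lt hc hd hT hN hz hw h_lt) hz hw
    fun h => h_lt.ne' (congrArg norm h)

theorem hasSum_div_of_norm_gt (hc : c ≠ 0) (hd : d ≠ 0)
    (hT : IsLaurentPolynomial (binomialMul c d T)) {N : ℤ} (hN : ∀ m ≤ N, ∀ n, T n m = 0)
    (hz : z ≠ 0) (hw : w ≠ 0) (h_lt : ‖c * z‖ < ‖d * w‖) :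
    HasSum (laurentTerm T z w) (laurentSum (binomialMul c d T) z w / (c * z - d * w)) := by
  have h_swap : IsLaurentPolynomial (binomialMul d c fun m n => T n m) :=
    (funext₂ fun m n => binomialMul_swap c d T n m) ▸ hT.neg_swap
  have h_summable := summable_of_norm_lt hd hc h_swap hN hw hz h_lt
  rw [← (Equiv.prodComm ℤ ℤ).summable_iff] at h_summable
  refine hasSum_div_of_summable (h_summable.congr fun p => ?_) hz hw
    fun h => h_lt.ne (congrArg norm h)
  simp only [laurentTerm, Function.comp_apply, Equiv.prodComm_apply, Prod.fst_swap, Prod.snd_swap]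
  ring

theorem IsLaurentPolynomial.analyticAt {P : ℤ → ℤ → ℂ} (hP : IsLaurentPolynomial P) {p : ℂ × ℂ}
    (h_fst : p.1 ≠ 0) (h_snd : p.2 ≠ 0) :
    AnalyticAt ℂ (fun p : ℂ × ℂ => laurentSum P p.1 p.2) p := by
  simp only [hP.laurentSum_eq, laurentTerm]
  exact Finset.analyticAt_fun_sum _ fun k _ =>
    (analyticAt_const.mul (analyticAt_fst.zpow h_fst)).mul (analyticAt_snd.zpow h_snd)

theorem IsLaurentPolynomial.differentiableAt_left {P : ℤ → ℤ → ℂ} (hP : IsLaurentPolynomial P)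
    {x y : ℂ} (hx : x ≠ 0) (hy : y ≠ 0) : DifferentiableAt ℂ (fun x' => laurentSum P x' y) x :=
  DifferentiableAt.comp (g := fun p : ℂ × ℂ => laurentSum P p.1 p.2) (f := fun x' => (x', y)) x
    (hP.analyticAt (p := (x, y)) hx hy).differentiableAt
    (differentiableAt_id.prodMk (differentiableAt_const y))

theorem IsLaurentPolynomial.differentiableAt_right {P : ℤ → ℤ → ℂ} (hP : IsLaurentPolynomial P)
    {x y : ℂ} (hx : x ≠ 0) (hy : y ≠ 0) : DifferentiableAt ℂ (fun y' => laurentSum P x y') y :=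
  DifferentiableAt.comp (g := fun p : ℂ × ℂ => laurentSum P p.1 p.2) (f := fun y' => (x, y')) y
    (hP.analyticAt (p := (x, y)) hx hy).differentiableAt
    ((differentiableAt_const x).prodMk differentiableAt_id)

end Laurent

/-! ### Uniqueness of Laurent coefficients -/

section Uniqueness

theorem inner_fourierLp_toLp_smul_fourier {L : ℝ} [Fact (0 < L)] (t : ℂ) (n m : ℤ) :
    innerSL ℂ (fourierLp (T := L) 2 n)
      (ContinuousMap.toLp (E := ℂ) 2 AddCircle.haarAddCircle ℂ
        (t • (fourier m : C(AddCircle L, ℂ)))) = if m = n then t else 0 := by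
  have h_orthonormal := orthonormal_iff_ite.1 (orthonormal_fourier (T := L)) n m
  simp only [fourierLp] at h_orthonormal ⊢
  rw [map_smul, map_smul, innerSL_apply_apply, h_orthonormal, smul_eq_mul, mul_ite, mul_one,
    mul_zero]
  simp only [eq_comm]

theorem eq_zero_of_forall_circle_hasSum {h : ℤ → ℂ} (h_summable : Summable h)
    (h_zero : ∀ u : Circle, HasSum (fun n => h n * (u : ℂ) ^ n) 0) (n : ℤ) : h n = 0 := by
  have : Fact (0 < 2 * π) := ⟨Real.two_pi_pos⟩
  have h_fourier : HasSum (fun n => h n • (fourier n : C(AddCircle (2 * π), ℂ))) 0 := by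
    have h_norm : Summable fun n => h n • (fourier n : C(AddCircle (2 * π), ℂ)) :=
      .of_norm <| by simpa only [norm_smul, fourier_norm, mul_one] using h_summable.norm
    convert h_norm.hasSum
    ext x
    refine (h_zero (AddCircle.toCircle x)).unique ?_
    refine ((ContinuousMap.evalCLM ℂ x).hasSum h_norm.hasSum).congr_fun fun n => ?_
    simp [fourier_apply, AddCircle.toCircle_zsmul]
  have h_coeff := (innerSL ℂ (fourierLp (T := 2 * π) 2 n)).hasSum <|
    (ContinuousMap.toLp (E := ℂ) 2 (AddCircle.haarAddCircle (T := 2 * π)) ℂ).hasSum h_fourier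
  simp only [map_zero, inner_fourierLp_toLp_smul_fourier] at h_coeff
  simpa using (hasSum_single n fun m hm => if_neg hm).unique h_coeff

theorem eq_zero_of_forall_circle_prod_hasSum {g : ℤ × ℤ → ℂ}
    (h_zero : ∀ u t : Circle, HasSum (fun p => g p * (u : ℂ) ^ p.1 * (t : ℂ) ^ p.2) 0)
    (n m : ℤ) : g (n, m) = 0 := by
  have h_row (t : Circle) (k : ℤ) : HasSum (fun l => g (k, l) * (t : ℂ) ^ l) 0 := by
    have h_summable : Summable fun p : ℤ × ℤ => g p * (t : ℂ) ^ p.2 := by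
      simpa using (h_zero 1 t).summable
    have h_sum := eq_zero_of_forall_circle_hasSum h_summable.prod (fun u => ?_) k
    · exact h_sum ▸ (h_summable.prod_factor k).hasSum
    · refine (h_zero u t).prod_fiberwise fun k => ?_
      exact ((h_summable.prod_factor k).hasSum.mul_right ((u : ℂ) ^ k)).congr_fun fun l => by ring
  have h_summable : Summable g := by simpa using (h_zero 1 1).summable
  exact eq_zero_of_forall_circle_hasSum (h_summable.prod_factor n) (h_row · n) m

theorem laurent_coeff_eq_zero {h : ℤ → ℤ → ℂ} {r₁ r₂ : ℝ} (hr₁ : 0 < r₁) (hr₂ : 0 < r₂)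
    (h_zero : ∀ z w : ℂ, ‖z‖ = r₁ → ‖w‖ = r₂ → HasSum (laurentTerm h z w) 0) (n m : ℤ) :
    h n m = 0 := by
  have norm_mul_circle {r : ℝ} (hr : 0 < r) (u : Circle) : ‖(r : ℂ) * (u⁻¹ : Circle)‖ = r := by
    rw [norm_mul, Circle.norm_coe, mul_one, Complex.norm_of_nonneg hr.le]
  have h_coeff := eq_zero_of_forall_circle_prod_hasSum
    (g := fun p => h p.1 p.2 * (r₁ : ℂ) ^ (-p.1) * (r₂ : ℂ) ^ (-p.2)) (fun u t => ?_) n m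
  · simpa [hr₁.ne', hr₂.ne', zpow_ne_zero] using h_coeff
  · refine (h_zero _ _ (norm_mul_circle hr₁ u) (norm_mul_circle hr₂ t)).congr_fun fun p => ?_
    simp only [laurentTerm, Circle.coe_inv, mul_zpow, inv_zpow', neg_neg]
    ring

end Uniqueness

/-! ### Formal and meromorphic exchange relations -/

section Exchange

variable {V : Type*} [AddCommGroup V] [Module ℂ V] {a b c d : ℂ} {X Y : ℤ → V → V}
  {ξ : V →ₗ[ℂ] ℂ}

theorem map_binomialMul (ξ : V →ₗ[ℂ] ℂ) (c d : ℂ) (S : ℤ → ℤ → V) (n m : ℤ) :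
    ξ (binomialMul c d S n m) = binomialMul c d (fun n m => ξ (S n m)) n m := by
  simp only [binomialMul, map_sub, map_smul]

theorem binomialMul_of_exchange (hd : d ≠ 0) (hX : IsSmooth X) (hY : ∀ m, Y m 0 = 0)
    (h : Exchange a b c d X Y) (n m : ℤ) (v : V) :
    binomialMul c d (fun n m => X n (Y m v)) n m =
      binomialMul a b (fun n m => Y m (X n v)) n m := by
  obtain ⟨N, hN⟩ := hX.exists_comp_eq_zero hY v
  simp only [h _ _ v]
  exact binomialMul_seriesMul_ratio a b c hd hN n m

theorem isLaurentPolynomial_of_exchange (hX : IsSmooth X) (hY : IsSmooth Y)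
    (hξX : IsRestrictedFor ξ X) (hξY : IsRestrictedFor ξ Y) (h : Exchange a b c d X Y) (v : V) :
    IsLaurentPolynomial fun n m => ξ (X n (Y m v)) := by
  obtain ⟨N₁, hN₁⟩ := hξX
  obtain ⟨N₂, hN₂⟩ := hX.exists_comp_eq_zero hY.map_zero v
  obtain ⟨M₁, hM₁⟩ := hξY
  obtain ⟨M₂, hM₂⟩ := hY.exists_comp_eq_zero hX.map_zero v
  refine isLaurentPolynomial_of_bounds (N₂ := N₂) (M₁ := M₁) (fun n hn m => hN₁ n hn _)
    (fun n hn m => ?_) (fun m hm n => ?_) (fun m hm n => by rw [hM₂ m hm, map_zero])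
  · rw [h, seriesMul_eq_zero _ fun k => hN₂ _ (by omega) _, map_zero]
  · rw [h, map_seriesMul ξ _ hN₂]
    exact finsum_eq_zero_of_forall_eq_zero fun k => by rw [hM₁ (m - k) (by omega), smul_zero]

theorem analyticExchange_of_exchange (ha : a ≠ 0) (hb : b ≠ 0) (hd : d ≠ 0) (hX : IsSmooth X)
    (hY : IsSmooth Y) (hξX : IsRestrictedFor ξ X) (hξY : IsRestrictedFor ξ Y)
    (h : Exchange a b c d X Y) (v : V) : AnalyticExchange a b c d X Y ξ v := by
  set T : ℤ → ℤ → ℂ := fun n m => ξ (X n (Y m v)) with hT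
  set U : ℤ → ℤ → ℂ := fun n m => ξ (Y m (X n v)) with hU
  have hT_laurent : IsLaurentPolynomial T := isLaurentPolynomial_of_exchange hX hY hξX hξY h v
  have h_eq : binomialMul a b U = binomialMul c d T := funext₂ fun n m => by
    rw [hT, hU, ← map_binomialMul ξ, ← map_binomialMul ξ,
      binomialMul_of_exchange hd hX hY.map_zero h]
  have hU_laurent : IsLaurentPolynomial (binomialMul a b U) := h_eq ▸ hT_laurent.binomialMul c d
  refine ⟨fun p => laurentSum T p.1 p.2,
    fun p => laurentSum (binomialMul a b U) p.1 p.2 / (a * p.1 - b * p.2),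
    ?_, ?_, fun z w _ _ => hT_laurent.hasSum z w, fun z w hz hw h_lt => ?_,
    fun z w hz hw h_num h_den => ?_⟩
  · rintro p ⟨h_fst, h_snd⟩
    exact hT_laurent.analyticAt h_fst h_snd
  · rintro p ⟨h_fst, h_snd, h_ne⟩
    exact (hU_laurent.analyticAt h_fst h_snd).div
      ((analyticAt_const.mul analyticAt_fst).sub (analyticAt_const.mul analyticAt_snd))
      (sub_ne_zero.2 h_ne)
  · obtain ⟨M, hM⟩ := hξY
    exact hasSum_div_of_norm_gt (T := U) ha hb hU_laurent (fun m hm n => hM m hm _) hz hw h_lt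
  · have h_mul : laurentSum (binomialMul a b U) z w = (c * z - d * w) * laurentSum T z w :=
      h_eq ▸ (hasSum_laurentTerm_binomialMul hz hw (hT_laurent.hasSum z w) c d).tsum_eq
    simp only [h_mul]
    rw [mul_div_assoc, ← mul_assoc, div_mul_cancel₀ _ (sub_ne_zero.2 h_den),
      mul_div_cancel₀ _ (sub_ne_zero.2 h_num)]

theorem binomialMul_of_analyticExchange (hb : b ≠ 0) (hd : d ≠ 0) {v : V}
    (h : AnalyticExchange a b c d X Y ξ v) (n m : ℤ) :
    binomialMul c d (fun n m => ξ (X n (Y m v))) n m =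
      binomialMul a b (fun n m => ξ (Y m (X n v))) n m := by
  obtain ⟨F, G, -, -, hF, hG, hFG⟩ := h
  have eventually_lt (x : ℂ) {y : ℂ} (hy : y ≠ 0) : ∀ᶠ r : ℝ in nhdsWithin 0 (Set.Ioi 0),
      ‖x‖ * r < ‖y‖ :=
    nhdsWithin_le_nhds <| (continuous_const.mul continuous_id).continuousAt.eventually_lt
      continuousAt_const (by simpa using hy)
  obtain ⟨r, ⟨h_num, h_den⟩, hr⟩ :=
    ((eventually_lt a hb).and (eventually_lt c hd)).and self_mem_nhdsWithin |>.exists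
  set T : ℤ → ℤ → ℂ := fun n m => ξ (X n (Y m v))
  set U : ℤ → ℤ → ℂ := fun n m => ξ (Y m (X n v))
  refine sub_eq_zero.1 (laurent_coeff_eq_zero
    (h := fun n m => binomialMul c d T n m - binomialMul a b U n m) hr one_pos
    (fun z w hz hw => ?_) n m)
  have hz₀ : z ≠ 0 := norm_pos_iff.1 (hz ▸ hr)
  have hw₀ : w ≠ 0 := norm_pos_iff.1 (hw ▸ one_pos)
  have h_num : ‖a * z‖ < ‖b * w‖ := by rwa [norm_mul, norm_mul, hz, hw, mul_one]
  have h_den : ‖c * z‖ < ‖d * w‖ := by rwa [norm_mul, norm_mul, hz, hw, mul_one]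
  have num_ne : a * z ≠ b * w := fun h => h_num.ne (congrArg norm h)
  have den_ne : c * z ≠ d * w := fun h => h_den.ne (congrArg norm h)
  have h_sub := (hasSum_laurentTerm_binomialMul (T := T) hz₀ hw₀ (hF z w hz₀ hw₀) c d).sub
    (hasSum_laurentTerm_binomialMul (T := U) hz₀ hw₀ (hG z w hz₀ hw₀ h_num) a b)
  rw [hFG z w hz₀ hw₀ num_ne den_ne, ← mul_assoc, mul_div_cancel₀ _ (sub_ne_zero.2 den_ne),
    sub_self] at h_sub
  exact h_sub.congr_fun fun p => by simp only [laurentTerm, sub_mul]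

/-- On the line `c z = d w` a multiple of the delta function has constant terms, so the only
convergent one is zero. -/
theorem eq_of_binomialMul_eq_of_summable (hc : c ≠ 0) (hd : d ≠ 0) {T R : ℤ → ℤ → ℂ}
    (h : ∀ n m, binomialMul c d T n m = binomialMul c d R n m)
    (hT : Summable (laurentTerm T d c)) {N : ℤ} (hR : ∀ n ≥ N, ∀ m, R n m = 0) (n m : ℤ) :
    T n m = R n m := by
  have h_sub (n m : ℤ) : binomialMul c d (fun n m => T n m - R n m) n m = 0 := by
    rw [binomialMul_sub, h, sub_self]
  refine sub_eq_zero.1 (eq_zero_of_binomialMul_eq_zero hc hd h_sub (fun t => ⟨N, ?_⟩) n m)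
  have h_inj : Function.Injective fun k : ℕ => ((N + k, t - N - k) : ℤ × ℤ) := fun k l h => by
    simpa using h
  have h_const (k : ℕ) : (laurentTerm T d c ∘ fun k : ℕ => ((N + k, t - N - k) : ℤ × ℤ)) k =
      (T 0 t - R 0 t) * c ^ (-t) := by
    have h_delta := eq_zpow_smul_of_binomialMul_eq_zero hc hd h_sub (N + k) (t - N - k)
    rw [hR _ (by omega), sub_zero, show N + k + (t - N - k) = t by ring] at h_delta
    rw [Function.comp_apply, laurentTerm, h_delta, smul_eq_mul, div_zpow, zpow_neg d,
      show -(t - N - (k : ℤ)) = N + k + -t by ring, zpow_add₀ hc _ (-t)]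
    field_simp
  have h_zero : T 0 t - R 0 t = 0 := by
    have h_summable := (hT.comp_injective h_inj).congr h_const
    simpa [zpow_ne_zero _ hc] using (summable_const_iff _).1 h_summable
  rw [eq_zpow_smul_of_binomialMul_eq_zero hc hd h_sub, add_sub_cancel, h_zero, smul_zero]

theorem apply_eq_of_analyticExchange (hb : b ≠ 0) (hc : c ≠ 0) (hd : d ≠ 0) (hX : IsSmooth X)
    (hY : ∀ m, Y m 0 = 0) {v : V} (h : AnalyticExchange a b c d X Y ξ v) (n m : ℤ) :
    ξ (X n (Y m v)) =
      ξ (seriesMul (ratio a b c d) (fun n m u => Y m (X n u)) n m v) := by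
  obtain ⟨N, hN⟩ := hX.exists_comp_eq_zero hY v
  have h_binomial (n m : ℤ) : binomialMul c d (fun n m => ξ (X n (Y m v))) n m =
      binomialMul c d (fun n m =>
        ξ (seriesMul (ratio a b c d) (fun n m u => Y m (X n u)) n m v)) n m := by
    rw [binomialMul_of_analyticExchange hb hd h, ← map_binomialMul ξ, ← map_binomialMul ξ,
      binomialMul_seriesMul_ratio a b c hd (S := fun n m u => Y m (X n u)) hN]
  have h_vanish (n : ℤ) (hn : n ≥ N) (m : ℤ) :
      ξ (seriesMul (ratio a b c d) (fun n m u => Y m (X n u)) n m v) = 0 := by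
    rw [seriesMul_eq_zero _ fun k => hN (n + k) (by omega) _, map_zero]
  obtain ⟨F, -, -, -, hF, -⟩ := h
  exact eq_of_binomialMul_eq_of_summable hc hd h_binomial (hF d c hd hc).summable h_vanish n m

theorem equivalentToExchange {ι : Type*} [DecidableEq ι] {A : Matrix ι ι ℤ} {q : ℂ}
    {ρ : Alg A q →ₐ[ℂ] Module.End ℂ V} {S : Prop} (ha : a ≠ 0) (hb : b ≠ 0) (hc : c ≠ 0)
    (hd : d ≠ 0) (hX : IsSmooth X) (hY : IsSmooth Y)
    (hρX : ∀ ξ, IsRestricted ρ ξ → IsRestrictedFor ξ X)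
    (hρY : ∀ ξ, IsRestricted ρ ξ → IsRestrictedFor ξ Y) (h : S ↔ Exchange a b c d X Y) :
    EquivalentToExchange ρ S a b c d X Y := by
  refine ⟨h, fun hS ξ v hξ => analyticExchange_of_exchange ha hb hd hX hY (hρX ξ hξ) (hρY ξ hξ)
    (h.1 hS) v, fun h_separates h_analytic => h.2 fun n m v => ?_⟩
  refine sub_eq_zero.1 (h_separates _ fun ξ hξ => ?_)
  rw [map_sub, apply_eq_of_analyticExchange hb hc hd hX hY.map_zero (h_analytic ξ v hξ), sub_self]

end Exchange

/-! ### Rescaling of currents -/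

section Rescale

variable {V : Type*} [AddCommGroup V] [Module ℂ V] {a b c d σ τ : ℂ}

theorem exchange_rescale_left (hσ : σ ≠ 0) (hτ : τ ≠ 0) (hd : d ≠ 0) (X : ℤ → V → V)
    (f : ℤ → Module.End ℂ V) :
    Exchange a b c d (fun n v => (σ * τ ^ n) • X n v) (modes f) ↔
      Exchange (a * τ) b (c * τ) d X (modes f) := by
  refine forall₃_congr fun n m v => ?_
  have h_series := seriesMul_smul (t := τ) (w := fun n _ => σ * τ ^ n)
    (fun n _ k => by rw [zpow_add₀ hτ, zpow_natCast]; ring) (ratio a b c d)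
    (fun n m u => f m (X n u)) n m v
  simp only [modes, map_smul, h_series, rescale_ratio hd]
  exact (smul_right_injective V (mul_ne_zero hσ (zpow_ne_zero n hτ))).eq_iff

theorem exchange_rescale_right (hσ : σ ≠ 0) (hτ : τ ≠ 0) (hd : d ≠ 0) (f : ℤ → Module.End ℂ V)
    (Y : ℤ → V → V) :
    Exchange a b c d (modes f) (fun m v => (σ * τ ^ m) • Y m v) ↔
      Exchange (a * τ⁻¹) b (c * τ⁻¹) d (modes f) Y := by
  refine forall₃_congr fun n m v => ?_
  have h_series := seriesMul_smul (t := τ⁻¹) (w := fun _ m => σ * τ ^ m)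
    (fun _ m k => by rw [zpow_sub₀ hτ, zpow_natCast, inv_pow]; ring) (ratio a b c d)
    (fun n m u => Y m (f n u)) n m v
  simp only [modes, map_smul, h_series, rescale_ratio hd]
  exact (smul_right_injective V (mul_ne_zero hσ (zpow_ne_zero m hτ))).eq_iff

theorem exchange_mul_left (hσ : σ ≠ 0) (hd : d ≠ 0) (X Y : ℤ → V → V) :
    Exchange (σ * a) (σ * b) (σ * c) (σ * d) X Y ↔ Exchange a b c d X Y := by
  rw [Exchange, ratio_mul_left hd hσ, Exchange]

end Rescale

/-! ### Composed currents as contour integrals -/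

section DeltaPart

variable {𝕜 : Type*} [NormedField 𝕜] {T : ℤ → ℤ → 𝕜} {F : ℤ → 𝕜} {s w : 𝕜} {N N' : ℤ}

theorem delta_coeff_eq_sum (hs : s ≠ 0) (hT : IsLaurentPolynomial (binomialMul 1 s T))
    (hN : ∀ n ≤ N, ∀ m, T n m = 0) (hF : ∀ n ≥ N', ∀ m, T n m = s ^ n * F (n + m)) (m : ℤ) :
    F m = ∑ p ∈ hT.toFinset,
      if m = p.1 + p.2 + 1 then binomialMul 1 s T p.1 p.2 * s ^ (-p.1 - 1) else 0 := by
  obtain ⟨N₁, hN₁⟩ := (hT.image Prod.fst).bddAbove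
  obtain ⟨n, hn, hn₁⟩ : ∃ n, N' ≤ n ∧ N₁ < n :=
    ⟨max N' (N₁ + 1), le_max_left _ _, Int.lt_iff_add_one_le.2 (le_max_right _ _)⟩
  rw [← mul_right_inj' (zpow_ne_zero n hs), ← congrArg F (add_sub_cancel n m), ← hF n hn,
    eq_sum_elementary one_ne_zero hs hT hN, Finset.mul_sum]
  refine Finset.sum_congr rfl fun p hp => ?_
  have hp_le : p.1 ≤ N₁ := hN₁ ⟨p, hT.mem_toFinset.1 hp, rfl⟩
  by_cases hm : m = p.1 + p.2 + 1
  · rw [elementary, if_pos ⟨by omega, by omega⟩, if_pos hm, inv_one, one_mul, div_one,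
      mul_left_comm, ← zpow_add₀ hs, show n - p.1 - 1 = n + (-p.1 - 1) by ring]
  · rw [elementary, if_neg (by omega), if_neg hm, mul_zero, mul_zero]

/-- The array `s ^ n * F (n + m)` is the delta function at `z = s w` times the series `F`, and as
this part of `T` is the difference of two expansions of one rational function, it is its residue. -/
theorem hasSum_delta_part (hs : s ≠ 0) (hT : IsLaurentPolynomial (binomialMul 1 s T))
    (hN : ∀ n ≤ N, ∀ m, T n m = 0) (hF : ∀ n ≥ N', ∀ m, T n m = s ^ n * F (n + m)) (hw : w ≠ 0) :
    HasSum (fun n => F n * w ^ (-n)) (laurentSum (binomialMul 1 s T) (s * w) w / (s * w)) := by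
  have h_sum := hasSum_sum fun (p : ℤ × ℤ) (_ : p ∈ hT.toFinset) => hasSum_ite_eq (p.1 + p.2 + 1)
    (binomialMul 1 s T p.1 p.2 * s ^ (-p.1 - 1) * w ^ (-(p.1 + p.2 + 1)))
  convert h_sum using 1
  · ext m
    rw [delta_coeff_eq_sum hs hT hN hF, Finset.sum_mul]
    refine Finset.sum_congr rfl fun p _ => ?_
    split_ifs with hm
    · rw [hm]
    · rw [zero_mul]
  · rw [hT.laurentSum_eq, Finset.sum_div]
    refine Finset.sum_congr rfl fun p _ => ?_
    rw [laurentTerm, mul_zpow, zpow_sub_one₀ hs, show -(p.1 + p.2 + 1) = -p.1 + -p.2 - 1 by ring,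
      zpow_sub_one₀ hw, zpow_add₀ hw, div_eq_mul_inv, mul_inv]
    ring

end DeltaPart

section MatrixCoefficient

variable {V : Type*} [AddCommGroup V] [Module ℂ V] {s : ℂ} {a b : ℤ → Module.End ℂ V}
  {ξ : V →ₗ[ℂ] ℂ} {v : V}

/-- The coefficients of the Laurent polynomial `(x - s y) ⟨ξ, a(x) b(y) v⟩`. -/
def numerator (s : ℂ) (a b : ℤ → Module.End ℂ V) (ξ : V →ₗ[ℂ] ℂ) (v : V) : ℤ → ℤ → ℂ :=
  binomialMul 1 s fun n m => ξ (a n (b m v))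

theorem numerator_eq_swap (hab : QuadraticRel s a b) (n m : ℤ) :
    numerator s a b ξ v n m = binomialMul s 1 (fun n m => ξ (b m (a n v))) n m := by
  have h_mul := congrArg ξ (LinearMap.congr_fun (hab n m) v)
  simp only [LinearMap.sub_apply, LinearMap.smul_apply, Module.End.mul_apply, map_sub,
    map_smul] at h_mul
  simpa only [numerator, binomialMul, one_smul] using h_mul

theorem isLaurentPolynomial_numerator (hab : QuadraticRel s a b) (ha : IsSmooth (modes a))
    (hb : IsSmooth (modes b)) (hξa : IsRestrictedFor ξ (modes a))
    (hξb : IsRestrictedFor ξ (modes b)) (v : V) : IsLaurentPolynomial (numerator s a b ξ v) := by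
  obtain ⟨N₁, hN₁⟩ := hξa
  obtain ⟨N₂, hN₂⟩ : ∃ N, ∀ n ≥ N, ∀ m, b m (a n v) = 0 :=
    ha.exists_comp_eq_zero (fun m => map_zero (b m)) v
  obtain ⟨M₁, hM₁⟩ := hξb
  obtain ⟨M₂, hM₂⟩ : ∃ M, ∀ m ≥ M, ∀ n, a n (b m v) = 0 :=
    hb.exists_comp_eq_zero (fun n => map_zero (a n)) v
  refine isLaurentPolynomial_of_bounds (N₁ := N₁ - 1) (N₂ := N₂) (M₁ := M₁ - 1) (M₂ := M₂)
    (fun n hn m => ?_) (fun n hn m => ?_) (fun m hm n => ?_) (fun m hm n => ?_)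
  · rw [numerator, binomialMul, hN₁ _ (by omega), hN₁ _ (by omega), smul_zero, smul_zero, sub_zero]
  · rw [numerator_eq_swap hab, binomialMul, hN₂ _ (by omega), hN₂ _ hn, map_zero, smul_zero,
      smul_zero, sub_zero]
  · rw [numerator_eq_swap hab, binomialMul, hM₁ _ (by omega), hM₁ _ (by omega), smul_zero,
      smul_zero, sub_zero]
  · rw [numerator, binomialMul, hM₂ _ hm, hM₂ _ (by omega), map_zero, smul_zero, smul_zero,
      sub_zero]

theorem hasSum_product_of_norm_lt (hs : s ≠ 0) (hP : IsLaurentPolynomial (numerator s a b ξ v))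
    (hξa : IsRestrictedFor ξ (modes a)) {x y : ℂ} (hx : x ≠ 0) (hy : y ≠ 0)
    (h_lt : ‖s * y‖ < ‖x‖) :
    HasSum (laurentTerm (fun n m => ξ (a n (b m v))) x y)
      (laurentSum (numerator s a b ξ v) x y / (x - s * y)) := by
  obtain ⟨N, hN⟩ := hξa
  simpa only [numerator, one_mul] using
    hasSum_div_of_norm_lt (T := fun n m => ξ (a n (b m v))) one_ne_zero hs
    hP (fun n hn m => hN n hn _) hx hy (by rwa [one_mul])

theorem hasSum_continued_of_norm_gt (hs : s ≠ 0) (hab : QuadraticRel s a b)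
    (hP : IsLaurentPolynomial (numerator s a b ξ v)) (ha : IsSmooth (modes a))
    (hξb : IsRestrictedFor ξ (modes b)) {x y : ℂ} (hx : x ≠ 0) (hy : y ≠ 0)
    (h_lt : ‖x‖ < ‖s * y‖) :
    HasSum (laurentTerm (fun n m => ξ (continued s (modes a) (modes b) n m v)) x y)
      (laurentSum (numerator s a b ξ v) x y / (x - s * y)) := by
  obtain ⟨N, hN⟩ := ha.exists_comp_eq_zero (Y := modes b) (fun m => map_zero (b m)) v
  obtain ⟨M, hM⟩ := hξb
  have h_numerator : numerator s a b ξ v =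
      binomialMul 1 s fun n m => ξ (continued s (modes a) (modes b) n m v) := funext₂ fun n m => by
    rw [numerator_eq_swap hab, ← map_binomialMul ξ, ← map_binomialMul ξ,
      binomialMul_continued hs ha]
  have h_vanish (m : ℤ) (hm : m ≤ M) (n : ℤ) :
      ξ (continued s (modes a) (modes b) n m v) = 0 :=
    (map_seriesMul ξ _ hN _ _).trans <| finsum_eq_zero_of_forall_eq_zero fun k => by
      rw [hM _ (by omega), smul_zero]
  rw [h_numerator] at hP ⊢
  simpa only [one_mul] using hasSum_div_of_norm_gt one_ne_zero hs hP h_vanish hx hy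
    (by rwa [one_mul])

theorem hasSum_fused (hs : s ≠ 0) (hab : QuadraticRel s a b)
    (hP : IsLaurentPolynomial (numerator s a b ξ v)) (ha : IsSmooth (modes a))
    (hξa : IsRestrictedFor ξ (modes a)) {y : ℂ} (hy : y ≠ 0) :
    HasSum (fun n => ξ (fused s a b n v) * y ^ (-n))
      (laurentSum (numerator s a b ξ v) (s * y) y / (s * y)) := by
  obtain ⟨N, hN⟩ := hξa
  obtain ⟨N', hN'⟩ := ha.eventually_zero v
  refine hasSum_delta_part (T := fun n m => ξ (a n (b m v))) hs hP (fun n hn m => hN n hn _)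
    (N' := N') (fun n hn m => ?_) hy
  rw [mul_apply_eq_fused_add_continued hs hab ha,
    continued_eq_zero fun k hk => hN' k (hn.le.trans hk), add_zero, map_smul, smul_eq_mul]

end MatrixCoefficient

section ContourIntegral

theorem circleIntegral_div_sub_div {f : ℂ → ℂ} {c : ℂ} {r : ℝ} (hr : 0 < r) (hrc : r < ‖c‖)
    (hf : DifferentiableOn ℂ f (Metric.closedBall c r)) :
    (2 * π * Complex.I)⁻¹ * ∮ w in C(c, r), f w / (w - c) / w = f c / c := by
  have h_div : DifferentiableOn ℂ (fun w => f w / w) (Metric.closedBall c r) :=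
    hf.div differentiableOn_id fun w hw hw₀ => by
      rw [hw₀, Metric.mem_closedBall, dist_zero_left] at hw
      exact hw.not_gt hrc
  have h_cauchy := h_div.circleIntegral_sub_inv_smul (Metric.mem_ball_self hr)
  have h_integrand (w : ℂ) : (w - c)⁻¹ • (f w / w) = f w / (w - c) / w := by
    rw [smul_eq_mul, inv_mul_eq_div, div_right_comm]
  simp only [h_integrand, smul_eq_mul] at h_cauchy
  rw [h_cauchy, ← mul_assoc, inv_mul_cancel₀ Complex.two_pi_I_ne_zero, one_mul]

variable {V : Type*} [AddCommGroup V] [Module ℂ V] {q : ℂ} {ξ : V →ₗ[ℂ] ℂ} {v : V}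

theorem isContourIntegral_of_simple_pole {outer inner : ℤ → ℤ → V → V} {C : ℤ → V → V}
    {f : ℂ → ℂ → ℂ} (hf : ∀ z ≠ 0, ∀ w ≠ 0, DifferentiableAt ℂ (f z) w)
    (h_outer : ∀ z ≠ 0, ∀ w ≠ 0, ‖q * z‖ < ‖w‖ →
      HasSum (laurentTerm (fun n m => ξ (outer n m v)) w (q ^ 2 * z)) (f z w / (w - q * z)))
    (h_inner : ∀ z ≠ 0, ∀ w ≠ 0, ‖w‖ < ‖q * z‖ →
      HasSum (laurentTerm (fun n m => ξ (inner n m v)) w (q ^ 2 * z)) (f z w / (w - q * z)))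
    (h_residue : ∀ z ≠ 0, HasSum (fun n => ξ (C n v) * z ^ (-n)) (f z (q * z) / (q * z))) :
    IsContourIntegral q outer inner C ξ v := by
  refine fun z hz => ⟨fun w => f z w / (w - q * z), ?_,
    fun w hw => h_outer z hz w (norm_pos_iff.1 ((norm_nonneg _).trans_lt hw)) hw,
    h_inner z hz, fun r hr hrz => ?_⟩
  · rintro w ⟨hw, hw_ne⟩
    exact ((hf z hz w hw).div (differentiableAt_id.sub_const _)
      (sub_ne_zero.2 hw_ne)).differentiableWithinAt
  · rw [circleIntegral_div_sub_div hr hrz fun w hw => (hf z hz w ?_).differentiableWithinAt]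
    · exact h_residue z hz
    · rintro rfl
      rw [Metric.mem_closedBall, dist_zero_left] at hw
      exact hw.not_gt hrz

end ContourIntegral

section Composed

variable {V : Type*} [AddCommGroup V] [Module ℂ V] {q : ℂ} {a b : ℤ → Module.End ℂ V}
  {ξ : V →ₗ[ℂ] ℂ}

theorem composedE_modes (q : ℂ) (a b : ℤ → Module.End ℂ V) :
    composedE q (modes a) (modes b) = fun n v => (1 * (q⁻¹ ^ 2) ^ n) • fused q⁻¹ a b n v := by
  ext n v
  rw [one_mul, inv_pow, inv_zpow', ← zpow_natCast, ← zpow_mul, mul_neg, ← neg_mul]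
  rfl

theorem composedF_modes (hq : q ≠ 0) (hba : QuadraticRel q b a) (hb : IsSmooth (modes b)) :
    composedF q (modes a) (modes b) = fun n v => (-1 * q⁻¹ ^ n) • fused q b a n v := by
  ext n v
  have h_fused := zpow_smul_fused hq hba hb n n v
  rw [sub_self] at h_fused
  calc composedF q (modes a) (modes b) n v
      = q ^ (-2 * n) • (continued q (modes b) (modes a) n 0 v - b n (a 0 v)) := rfl
    _ = (-1 * q⁻¹ ^ n) • fused q b a n v := by
      rw [← neg_sub, ← h_fused, smul_neg, smul_smul, ← zpow_add₀ hq, neg_one_mul, neg_smul,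
        inv_zpow', show -2 * n + n = -n by ring]

theorem isContourIntegral_composedE (hq : q ≠ 0) (hab : QuadraticRel q⁻¹ a b)
    (ha : IsSmooth (modes a)) (hb : IsSmooth (modes b)) (hξa : IsRestrictedFor ξ (modes a))
    (hξb : IsRestrictedFor ξ (modes b)) (v : V) :
    IsContourIntegral q (outerE (modes a) (modes b)) (innerE q (modes a) (modes b))
      (composedE q (modes a) (modes b)) ξ v := by
  have hq_inv := inv_ne_zero hq
  have hP := isLaurentPolynomial_numerator hab ha hb hξa hξb v
  have h_point (z : ℂ) : q⁻¹ * (q ^ 2 * z) = q * z := by field_simp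
  have h_ne {z : ℂ} (hz : z ≠ 0) : q ^ 2 * z ≠ 0 := mul_ne_zero (pow_ne_zero 2 hq) hz
  refine isContourIntegral_of_simple_pole
    (f := fun z w => laurentSum (numerator q⁻¹ a b ξ v) w (q ^ 2 * z)) (fun z hz w hw => ?_)
    (fun z hz w hw h_lt => ?_) (fun z hz w hw h_lt => ?_) (fun z hz => ?_)
  · exact hP.differentiableAt_left hw (h_ne hz)
  · rw [← h_point] at h_lt ⊢
    exact hasSum_product_of_norm_lt hq_inv hP hξa hw (h_ne hz) h_lt
  · rw [← h_point] at h_lt ⊢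
    exact hasSum_continued_of_norm_gt hq_inv hab hP ha hξb hw (h_ne hz) h_lt
  · have h_fused := hasSum_fused hq_inv hab hP ha hξa (h_ne hz)
    rw [h_point] at h_fused
    refine h_fused.congr_fun fun n => ?_
    rw [composedE_modes, map_smul, smul_eq_mul, one_mul, mul_zpow, inv_pow, inv_zpow']
    ring

theorem hasSum_laurentTerm_swap {T : ℤ → ℤ → ℂ} {z w F : ℂ} (hT : HasSum (laurentTerm T z w) F) :
    HasSum (laurentTerm (fun m n => T n m) w z) F :=
  ((Equiv.prodComm ℤ ℤ).hasSum_iff.2 hT).congr_fun fun _ => mul_right_comm _ _ _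

theorem isContourIntegral_composedF (hq : q ≠ 0) (hba : QuadraticRel q b a)
    (ha : IsSmooth (modes a)) (hb : IsSmooth (modes b)) (hξa : IsRestrictedFor ξ (modes a))
    (hξb : IsRestrictedFor ξ (modes b)) (v : V) :
    IsContourIntegral q (outerF q (modes a) (modes b)) (innerF (modes a) (modes b))
      (composedF q (modes a) (modes b)) ξ v := by
  have hP := isLaurentPolynomial_numerator hba hb ha hξb hξa v
  have h_point (z : ℂ) : q ^ 2 * z = q * (q * z) := by ring
  have h_ne {z : ℂ} (hz : z ≠ 0) : q ^ 2 * z ≠ 0 := mul_ne_zero (pow_ne_zero 2 hq) hz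
  have h_norm {x y : ℂ} (h_lt : ‖x‖ < ‖y‖) : ‖q * x‖ < ‖q * y‖ := by
    rw [norm_mul, norm_mul]
    exact mul_lt_mul_of_pos_left h_lt (norm_pos_iff.2 hq)
  have h_pole (x z w : ℂ) : -q⁻¹ * x / (w - q * z) = x / (q ^ 2 * z - q * w) := by
    rw [show q ^ 2 * z - q * w = -q * (w - q * z) by ring, div_eq_mul_inv, div_eq_mul_inv,
      mul_inv, inv_neg]
    ring
  refine isContourIntegral_of_simple_pole
    (f := fun z w => -q⁻¹ * laurentSum (numerator q b a ξ v) (q ^ 2 * z) w) (fun z hz w hw => ?_)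
    (fun z hz w hw h_lt => ?_) (fun z hz w hw h_lt => ?_) (fun z hz => ?_)
  · exact (hP.differentiableAt_right (h_ne hz) hw).const_mul _
  · rw [h_pole]
    exact hasSum_laurentTerm_swap <| hasSum_continued_of_norm_gt hq hba hP hb hξa (h_ne hz) hw <|
      h_point z ▸ h_norm h_lt
  · rw [h_pole]
    exact hasSum_laurentTerm_swap <| hasSum_product_of_norm_lt hq hP hξb (h_ne hz) hw <|
      h_point z ▸ h_norm h_lt
  · have h_fused := (hasSum_fused hq hba hP hb hξb (mul_ne_zero hq hz)).neg
    rw [← h_point] at h_fused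
    have h_residue (x : ℂ) : -(x / (q ^ 2 * z)) = -q⁻¹ * x / (q * z) := by
      field_simp
    rw [h_residue] at h_fused
    refine h_fused.congr_fun fun n => ?_
    rw [composedF_modes hq hba hb, map_smul, smul_eq_mul, mul_zpow, inv_zpow']
    ring

theorem serre_eq_zero_iff_exchange_composedE_left (hq : q ≠ 0) (hab : QuadraticRel q⁻¹ a b)
    (haa : QuadraticRel (q ^ 2) a a) (ha : IsSmooth (modes a)) :
    (∀ i j k, serre q a b i j k = 0) ↔
      Exchange q 1 1 q (modes a) (composedE q (modes a) (modes b)) := by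
  have hq_inv := inv_ne_zero hq
  rw [composedE_modes, exchange_rescale_right one_ne_zero (pow_ne_zero 2 hq_inv) hq, ← serre_inv,
    serre_eq_zero_iff_exchange_left hq_inv hab (by rwa [inv_pow, inv_inv]) ha,
    ← exchange_mul_left (pow_ne_zero 2 hq) hq_inv]
  congr! 1 <;> field_simp

theorem serre_eq_zero_iff_exchange_composedE_right (hq : q ≠ 0) (hab : QuadraticRel q⁻¹ a b)
    (hbb : QuadraticRel (q ^ 2) b b) (ha : IsSmooth (modes a)) :
    (∀ i j k, serre q b a i j k = 0) ↔
      Exchange (q ^ 2) (q⁻¹ ^ 2) q q⁻¹ (composedE q (modes a) (modes b)) (modes b) := by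
  have hq_inv := inv_ne_zero hq
  rw [composedE_modes, exchange_rescale_left one_ne_zero (pow_ne_zero 2 hq_inv) hq_inv, ← serre_inv,
    serre_eq_zero_iff_exchange_right hq_inv hab (by rwa [inv_pow, inv_inv]) ha]
  congr! 1 <;> field_simp

theorem serre_eq_zero_iff_exchange_composedF_left (hq : q ≠ 0) (hba : QuadraticRel q b a)
    (hbb : QuadraticRel (q ^ 2)⁻¹ b b) (hb : IsSmooth (modes b)) :
    (∀ i j k, serre q b a i j k = 0) ↔
      Exchange (q⁻¹ ^ 2) (q ^ 2) q⁻¹ q (modes b) (composedF q (modes a) (modes b)) := by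
  rw [composedF_modes hq hba hb,
    exchange_rescale_right (neg_ne_zero.2 one_ne_zero) (inv_ne_zero hq) hq,
    serre_eq_zero_iff_exchange_left hq hba hbb hb]
  congr! 1 <;> field_simp

theorem serre_eq_zero_iff_exchange_composedF_right (hq : q ≠ 0) (hba : QuadraticRel q b a)
    (haa : QuadraticRel (q ^ 2)⁻¹ a a) (hb : IsSmooth (modes b)) :
    (∀ i j k, serre q a b i j k = 0) ↔
      Exchange q⁻¹ 1 1 q⁻¹ (composedF q (modes a) (modes b)) (modes a) := by
  have hq_inv := inv_ne_zero hq
  rw [composedF_modes hq hba hb, exchange_rescale_left (neg_ne_zero.2 one_ne_zero) hq_inv hq_inv,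
    serre_eq_zero_iff_exchange_right hq hba haa hb,
    ← exchange_mul_left (pow_ne_zero 2 hq_inv) hq]
  congr! 1 <;> field_simp

theorem isSmooth_composedE (hq : q ≠ 0) (hab : QuadraticRel q⁻¹ a b) (ha : IsSmooth (modes a))
    (hb : IsSmooth (modes b)) : IsSmooth (composedE q (modes a) (modes b)) :=
  composedE_modes q a b ▸ (isSmooth_fused (inv_ne_zero hq) hab ha hb).smul _

theorem isSmooth_composedF (hq : q ≠ 0) (hba : QuadraticRel q b a) (ha : IsSmooth (modes a))
    (hb : IsSmooth (modes b)) : IsSmooth (composedF q (modes a) (modes b)) :=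
  composedF_modes hq hba hb ▸ (isSmooth_fused hq hba hb ha).smul _

theorem isRestrictedFor_composedE (hq : q ≠ 0) (hab : QuadraticRel q⁻¹ a b)
    (ha : IsSmooth (modes a)) (hξa : IsRestrictedFor ξ (modes a))
    (hξb : IsRestrictedFor ξ (modes b)) :
    IsRestrictedFor ξ (composedE q (modes a) (modes b)) :=
  composedE_modes q a b ▸ (isRestrictedFor_fused (inv_ne_zero hq) hab ha hξa hξb).smul _

theorem isRestrictedFor_composedF (hq : q ≠ 0) (hba : QuadraticRel q b a)
    (hb : IsSmooth (modes b)) (hξa : IsRestrictedFor ξ (modes a))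
    (hξb : IsRestrictedFor ξ (modes b)) :
    IsRestrictedFor ξ (composedF q (modes a) (modes b)) :=
  composedF_modes hq hba hb ▸ (isRestrictedFor_fused hq hba hb hξb hξa).smul _

end Composed

/-! ### Currents of a representation -/

section Representation

variable {ι : Type*} [DecidableEq ι] {A : Matrix ι ι ℤ} {q : ℂ}
  {V : Type*} [AddCommGroup V] [Module ℂ V] {ρ : Alg A q →ₐ[ℂ] Module.End ℂ V}

/-- The mode `e_{i,n}` as an endomorphism; `modes` of this family of endomorphisms is `eCur`. -/
def eOperator (ρ : Alg A q →ₐ[ℂ] Module.End ℂ V) (i : ι) (n : ℤ) : Module.End ℂ V :=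
  ρ (eMode A q i n)

/-- The mode `f_{i,n}` as an endomorphism; `modes` of this family of endomorphisms is `fCur`. -/
def fOperator (ρ : Alg A q →ₐ[ℂ] Module.End ℂ V) (i : ι) (n : ℤ) : Module.End ℂ V :=
  ρ (fMode A q i n)

theorem quadraticRel_eOperator (ρ : Alg A q →ₐ[ℂ] Module.End ℂ V) {i j : ι} {p : ℂ}
    (hp : q ^ A i j = p) : QuadraticRel p (eOperator ρ i) (eOperator ρ j) := by
  refine QuadraticRel.map (fun n m => ?_) ρ
  have h_rel := RingQuot.mkAlgHom_rel ℂ (Rel.ee (A := A) (q := q) i j n m)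
  simp only [map_sub, map_mul, map_smul, hp] at h_rel
  exact h_rel

theorem quadraticRel_fOperator (ρ : Alg A q →ₐ[ℂ] Module.End ℂ V) {i j : ι} {p : ℂ}
    (hp : q ^ (-A i j) = p) : QuadraticRel p (fOperator ρ i) (fOperator ρ j) := by
  refine QuadraticRel.map (fun n m => ?_) ρ
  have h_rel := RingQuot.mkAlgHom_rel ℂ (Rel.ff (A := A) (q := q) i j n m)
  simp only [map_sub, map_mul, map_smul, hp] at h_rel
  exact h_rel

theorem quadraticRel_eOperator_of_eq_neg_one (ρ : Alg A q →ₐ[ℂ] Module.End ℂ V) {i j : ι}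
    (hij : A i j = -1) : QuadraticRel q⁻¹ (eOperator ρ i) (eOperator ρ j) :=
  quadraticRel_eOperator ρ (by rw [hij, zpow_neg_one])

theorem quadraticRel_eOperator_self (ρ : Alg A q →ₐ[ℂ] Module.End ℂ V) {i : ι}
    (hi : A i i = 2) : QuadraticRel (q ^ 2) (eOperator ρ i) (eOperator ρ i) :=
  quadraticRel_eOperator ρ (by rw [hi, zpow_ofNat])

theorem quadraticRel_fOperator_of_eq_neg_one (ρ : Alg A q →ₐ[ℂ] Module.End ℂ V) {i j : ι}
    (hij : A i j = -1) : QuadraticRel q (fOperator ρ j) (fOperator ρ i) :=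
  (quadraticRel_fOperator ρ (by rw [hij, neg_neg, zpow_one])).symm

theorem quadraticRel_fOperator_self (ρ : Alg A q →ₐ[ℂ] Module.End ℂ V) {i : ι}
    (hi : A i i = 2) : QuadraticRel (q ^ 2)⁻¹ (fOperator ρ i) (fOperator ρ i) :=
  quadraticRel_fOperator ρ (by rw [hi, zpow_neg, zpow_ofNat])

theorem isSmooth_eCur (hρ : IsHighestWeight ρ) (i : ι) : IsSmooth (eCur ρ i) :=
  ⟨fun _ => map_zero _, fun v => (hρ v i).imp fun _ hN n hn => (hN n hn).1⟩

theorem isSmooth_fCur (hρ : IsHighestWeight ρ) (i : ι) : IsSmooth (fCur ρ i) :=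
  ⟨fun _ => map_zero _, fun v => (hρ v i).imp fun _ hN n hn => (hN n hn).2⟩

theorem isRestrictedFor_eCur {ξ : V →ₗ[ℂ] ℂ} (hξ : IsRestricted ρ ξ) (i : ι) :
    IsRestrictedFor ξ (eCur ρ i) :=
  (hξ i).imp fun _ hN n hn v => (hN n hn v).1

theorem isRestrictedFor_fCur {ξ : V →ₗ[ℂ] ℂ} (hξ : IsRestricted ρ ξ) (i : ι) :
    IsRestrictedFor ξ (fCur ρ i) :=
  (hξ i).imp fun _ hN n hn v => (hN n hn v).2

theorem isSmooth_composedE_eCur (hq : q ≠ 0) (hρ : IsHighestWeight ρ) {i j : ι}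
    (hij : A i j = -1) : IsSmooth (composedE q (eCur ρ i) (eCur ρ j)) :=
  isSmooth_composedE hq (quadraticRel_eOperator_of_eq_neg_one ρ hij) (isSmooth_eCur hρ i)
    (isSmooth_eCur hρ j)

theorem isSmooth_composedF_fCur (hq : q ≠ 0) (hρ : IsHighestWeight ρ) {i j : ι}
    (hij : A i j = -1) : IsSmooth (composedF q (fCur ρ i) (fCur ρ j)) :=
  isSmooth_composedF hq (quadraticRel_fOperator_of_eq_neg_one ρ hij) (isSmooth_fCur hρ i)
    (isSmooth_fCur hρ j)

theorem isRestrictedFor_composedE_eCur (hq : q ≠ 0) (hρ : IsHighestWeight ρ) {i j : ι}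
    (hij : A i j = -1) {ξ : V →ₗ[ℂ] ℂ} (hξ : IsRestricted ρ ξ) :
    IsRestrictedFor ξ (composedE q (eCur ρ i) (eCur ρ j)) :=
  isRestrictedFor_composedE hq (quadraticRel_eOperator_of_eq_neg_one ρ hij) (isSmooth_eCur hρ i)
    (isRestrictedFor_eCur hξ i) (isRestrictedFor_eCur hξ j)

theorem isRestrictedFor_composedF_fCur (hq : q ≠ 0) (hρ : IsHighestWeight ρ) {i j : ι}
    (hij : A i j = -1) {ξ : V →ₗ[ℂ] ℂ} (hξ : IsRestricted ρ ξ) :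
    IsRestrictedFor ξ (composedF q (fCur ρ i) (fCur ρ j)) :=
  isRestrictedFor_composedF hq (quadraticRel_fOperator_of_eq_neg_one ρ hij) (isSmooth_fCur hρ j)
    (isRestrictedFor_fCur hξ i) (isRestrictedFor_fCur hξ j)

theorem serreE_iff (ρ : Alg A q →ₐ[ℂ] Module.End ℂ V) (i j : ι) :
    SerreE ρ i j ↔ ∀ n₁ n₂ m, serre q (eOperator ρ i) (eOperator ρ j) n₁ n₂ m = 0 := by
  simp only [SerreE, map_serre]
  rfl

theorem serreF_iff (ρ : Alg A q →ₐ[ℂ] Module.End ℂ V) (i j : ι) :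
    SerreF ρ i j ↔ ∀ n₁ n₂ m, serre q (fOperator ρ i) (fOperator ρ j) n₁ n₂ m = 0 := by
  simp only [SerreF, map_serre]
  rfl

theorem equivalentToExchange_serreE_left (hq : q ≠ 0) (hρ : IsHighestWeight ρ) {i j : ι}
    (hi : A i i = 2) (hij : A i j = -1) :
    EquivalentToExchange ρ (SerreE ρ i j) q 1 1 q (eCur ρ i)
      (composedE q (eCur ρ i) (eCur ρ j)) :=
  equivalentToExchange hq one_ne_zero one_ne_zero hq (isSmooth_eCur hρ i)
    (isSmooth_composedE_eCur hq hρ hij) (fun _ hξ => isRestrictedFor_eCur hξ i)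
    (fun _ hξ => isRestrictedFor_composedE_eCur hq hρ hij hξ) <|
    (serreE_iff ρ i j).trans <| serre_eq_zero_iff_exchange_composedE_left hq
      (quadraticRel_eOperator_of_eq_neg_one ρ hij) (quadraticRel_eOperator_self ρ hi)
      (isSmooth_eCur hρ i)

theorem equivalentToExchange_serreE_right (hq : q ≠ 0) (hρ : IsHighestWeight ρ) {i j : ι}
    (hj : A j j = 2) (hij : A i j = -1) :
    EquivalentToExchange ρ (SerreE ρ j i) (q ^ 2) (q⁻¹ ^ 2) q q⁻¹
      (composedE q (eCur ρ i) (eCur ρ j)) (eCur ρ j) :=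
  equivalentToExchange (pow_ne_zero 2 hq) (pow_ne_zero 2 (inv_ne_zero hq)) hq (inv_ne_zero hq)
    (isSmooth_composedE_eCur hq hρ hij) (isSmooth_eCur hρ j)
    (fun _ hξ => isRestrictedFor_composedE_eCur hq hρ hij hξ)
    (fun _ hξ => isRestrictedFor_eCur hξ j) <|
    (serreE_iff ρ j i).trans <| serre_eq_zero_iff_exchange_composedE_right hq
      (quadraticRel_eOperator_of_eq_neg_one ρ hij) (quadraticRel_eOperator_self ρ hj)
      (isSmooth_eCur hρ i)

theorem equivalentToExchange_serreF_left (hq : q ≠ 0) (hρ : IsHighestWeight ρ) {i j : ι}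
    (hj : A j j = 2) (hij : A i j = -1) :
    EquivalentToExchange ρ (SerreF ρ j i) (q⁻¹ ^ 2) (q ^ 2) q⁻¹ q (fCur ρ j)
      (composedF q (fCur ρ i) (fCur ρ j)) :=
  equivalentToExchange (pow_ne_zero 2 (inv_ne_zero hq)) (pow_ne_zero 2 hq) (inv_ne_zero hq) hq
    (isSmooth_fCur hρ j) (isSmooth_composedF_fCur hq hρ hij)
    (fun _ hξ => isRestrictedFor_fCur hξ j)
    (fun _ hξ => isRestrictedFor_composedF_fCur hq hρ hij hξ) <|
    (serreF_iff ρ j i).trans <| serre_eq_zero_iff_exchange_composedF_left hq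
      (quadraticRel_fOperator_of_eq_neg_one ρ hij) (quadraticRel_fOperator_self ρ hj)
      (isSmooth_fCur hρ j)

theorem equivalentToExchange_serreF_right (hq : q ≠ 0) (hρ : IsHighestWeight ρ) {i j : ι}
    (hi : A i i = 2) (hij : A i j = -1) :
    EquivalentToExchange ρ (SerreF ρ i j) q⁻¹ 1 1 q⁻¹
      (composedF q (fCur ρ i) (fCur ρ j)) (fCur ρ i) :=
  equivalentToExchange (inv_ne_zero hq) one_ne_zero one_ne_zero (inv_ne_zero hq)
    (isSmooth_composedF_fCur hq hρ hij) (isSmooth_fCur hρ i)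
    (fun _ hξ => isRestrictedFor_composedF_fCur hq hρ hij hξ)
    (fun _ hξ => isRestrictedFor_fCur hξ i) <|
    (serreF_iff ρ i j).trans <| serre_eq_zero_iff_exchange_composedF_right hq
      (quadraticRel_fOperator_of_eq_neg_one ρ hij) (quadraticRel_fOperator_self ρ hi)
      (isSmooth_fCur hρ j)

end Representation

end

end DrinfeldCurrent

theorem proposition1_general {ι : Type*} [DecidableEq ι] (A : Matrix ι ι ℤ) (q : ℂ) (hq : q ≠ 0)
    {V : Type*} [AddCommGroup V] [Module ℂ V] (ρ : Alg A q →ₐ[ℂ] Module.End ℂ V)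
    (hρ : IsHighestWeight ρ) (α β : ι) (hα : A α α = 2) (hβ : A β β = 2) (hαβ : A α β = -1) :
    (∀ (ξ : V →ₗ[ℂ] ℂ) (v : V), IsRestricted ρ ξ →
      IsContourIntegral q (outerE (eCur ρ α) (eCur ρ β)) (innerE q (eCur ρ α) (eCur ρ β))
        (composedE q (eCur ρ α) (eCur ρ β)) ξ v ∧
      IsContourIntegral q (outerF q (fCur ρ α) (fCur ρ β)) (innerF (fCur ρ α) (fCur ρ β))
        (composedF q (fCur ρ α) (fCur ρ β)) ξ v) ∧
    EquivalentToExchange ρ (SerreE ρ α β) q 1 1 q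
      (eCur ρ α) (composedE q (eCur ρ α) (eCur ρ β)) ∧
    EquivalentToExchange ρ (SerreE ρ β α) (q ^ 2) (q⁻¹ ^ 2) q q⁻¹
      (composedE q (eCur ρ α) (eCur ρ β)) (eCur ρ β) ∧
    EquivalentToExchange ρ (SerreF ρ β α) (q⁻¹ ^ 2) (q ^ 2) q⁻¹ q
      (fCur ρ β) (composedF q (fCur ρ α) (fCur ρ β)) ∧
    EquivalentToExchange ρ (SerreF ρ α β) q⁻¹ 1 1 q⁻¹
      (composedF q (fCur ρ α) (fCur ρ β)) (fCur ρ α) := by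
  refine ⟨fun ξ v hξ => ⟨?_, ?_⟩, ?_, ?_, ?_, ?_⟩
  · exact isContourIntegral_composedE hq (quadraticRel_eOperator_of_eq_neg_one ρ hαβ)
      (isSmooth_eCur hρ α) (isSmooth_eCur hρ β) (isRestrictedFor_eCur hξ α)
      (isRestrictedFor_eCur hξ β) v
  · exact isContourIntegral_composedF hq (quadraticRel_fOperator_of_eq_neg_one ρ hαβ)
      (isSmooth_fCur hρ α) (isSmooth_fCur hρ β) (isRestrictedFor_fCur hξ α)
      (isRestrictedFor_fCur hξ β) v
  · exact equivalentToExchange_serreE_left hq hρ hα hαβ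
  · exact equivalentToExchange_serreE_right hq hρ hβ hαβ
  · exact equivalentToExchange_serreF_left hq hρ hβ hαβ
  · exact equivalentToExchange_serreF_right hq hρ hα hαβ

theorem proposition1 {ι : Type*} [DecidableEq ι] (A : Matrix ι ι ℤ) (hA : IsSimplyLacedCartan A)
    (q : ℂ) (hq : q ≠ 0) (hq2 : q ^ 2 ≠ 1)
    {V : Type*} [AddCommGroup V] [Module ℂ V] (ρ : Alg A q →ₐ[ℂ] Module.End ℂ V)
    (hρ : IsHighestWeight ρ) (α β : ι) (hαβ : A α β = -1) :
    -- the composed root currents are contour integrals of the continued products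
    (∀ (ξ : V →ₗ[ℂ] ℂ) (v : V), IsRestricted ρ ξ →
      IsContourIntegral q (outerE (eCur ρ α) (eCur ρ β)) (innerE q (eCur ρ α) (eCur ρ β))
        (composedE q (eCur ρ α) (eCur ρ β)) ξ v ∧
      IsContourIntegral q (outerF q (fCur ρ α) (fCur ρ β)) (innerF (fCur ρ α) (fCur ρ β))
        (composedF q (fCur ρ α) (fCur ρ β)) ξ v) ∧
    -- e_α(z) e_{α+β}(w) = (q z - w)/(z - q w) e_{α+β}(w) e_α(z)
    EquivalentToExchange ρ (SerreE ρ α β) q 1 1 q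
      (eCur ρ α) (composedE q (eCur ρ α) (eCur ρ β)) ∧
    -- e_{α+β}(z) e_β(w) = (q² z - q⁻² w)/(q z - q⁻¹ w) e_β(w) e_{α+β}(z)
    EquivalentToExchange ρ (SerreE ρ β α) (q ^ 2) (q⁻¹ ^ 2) q q⁻¹
      (composedE q (eCur ρ α) (eCur ρ β)) (eCur ρ β) ∧
    -- f_β(z) f_{α+β}(w) = (q⁻² z - q² w)/(q⁻¹ z - q w) f_{α+β}(w) f_β(z)
    EquivalentToExchange ρ (SerreF ρ β α) (q⁻¹ ^ 2) (q ^ 2) q⁻¹ q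
      (fCur ρ β) (composedF q (fCur ρ α) (fCur ρ β)) ∧
    -- f_{α+β}(z) f_α(w) = (q⁻¹ z - w)/(z - q⁻¹ w) f_α(w) f_{α+β}(z)
    EquivalentToExchange ρ (SerreF ρ α β) q⁻¹ 1 1 q⁻¹
      (composedF q (fCur ρ α) (fCur ρ β)) (fCur ρ α) := by
  exact proposition1_general A q hq ρ hρ α β (hA.diag α) (hA.diag β) hαβ
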